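/- Let $G$ be a finite simple graph that is toroidal, i.e. that can be embedded in the torus (planar graphs are included; combinatorially: $G$ has a rotation system for which the genera of its connected components add up to at most $1$). Suppose that $G$ has no subgraph (induced or not) isomorphic to one of the following six graphs, in which no vertices and edges other than those described are present or identified: (a) a $4$-cycle with a chord; (b) a $5$-cycle with a chord; (c) a $6$-cycle with a chord joining two opposite vertices; (d) a $6$-cycle $v_1v_2\dots v_6$ and one further vertex adjacent to exactly $v_1$ and $v_2$; (e) a $5$-cycle $v_1v_2v_3v_4v_5$ together with a triangle $v_2v_3x$ and a $4$-cycle $v_1v_2yz$, where $x,y,z$ are three further vertices; (f) a $5$-cycle $v_1v_2v_3v_4v_5$ together with a triangle $v_3v_4x$ and a $4$-cycle $v_1v_2yz$, where $x,y,z$ are three further vertices. Then $G$ is $(2,1)$-decomposable: it has a subgraph $H$ of maximum degree $\Delta(H)\le 1$ such that $G-E(H)$ is $2$-degenerate, i.e. every nonempty subgraph of $G-E(H)$ has a vertex of degree at most $2$. Moreover, for each $(i,j)\in\{(3,4),(3,6),(4,6),(4,7)\}$, every toroidal graph that contains neither a cycle of length $i$ nor a cycle of length $j$ contains none of the graphs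 (a)–(f) as a subgraph (so that it is $(2,1)$-decomposable). -/

import Mathlib

namespace ToroidalDecomposition

/-- A rotation system on a simple graph `G`: a permutation of the darts (oriented edges) whose
cycles are exactly the sets of darts leaving a given non-isolated vertex, that is, a cyclic order
of the edge-ends around every vertex. Rotation systems are the combinatorial form of the 2-cell
embeddings of the components of `G` in closed orientable surfaces. -/
structure RotationSystem {V : Type*} (G : SimpleGraph V) where
  /-- The next dart around the initial vertex. -/
  next : Equiv.Perm G.Dart
  next_fst : ∀ d : G.Dart, (next d).fst = d.fst
  sameCycle_of_fst_eq : ∀ d e : G.Dart, d.fst = e.fst → next.SameCycle d e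

/-- The reversal of darts, as a permutation. -/
def dartReverse {V : Type*} (G : SimpleGraph V) : Equiv.Perm G.Dart where
  toFun := SimpleGraph.Dart.symm
  invFun := SimpleGraph.Dart.symm
  left_inv := SimpleGraph.Dart.symm_symm
  right_inv := SimpleGraph.Dart.symm_symm

namespace RotationSystem

variable {V : Type*} {G : SimpleGraph V} (ρ : RotationSystem G)

/-- Face tracing: traverse a dart, then leave its terminal vertex along the next dart. -/
def facePerm : Equiv.Perm G.Dart := ρ.next * dartReverse G

/-- The number of faces, counted over the components separately: one face for every cycle of the
face-tracing permutation (fixed points included), and one face for every isolated vertex (alone on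
a sphere). -/
noncomputable def numFaces : ℕ :=
  Nat.card (Quotient (Equiv.Perm.SameCycle.setoid ρ.facePerm)) +
    Nat.card {v : V // ∀ w, ¬ G.Adj v w}

/-- `|V| - |E| + |F|`: the sum of the Euler characteristics of the surfaces that carry the
components. -/
noncomputable def eulerChar : ℤ :=
  (Nat.card V : ℤ) - (Nat.card G.edgeSet : ℤ) + (ρ.numFaces : ℤ)

end RotationSystem

/-- A finite graph is toroidal if it can be embedded in the torus (planar graphs included): it has
a rotation system of total genus at most one. If the components are 2-cell embedded in surfaces of
genus `g₁, …, g_c`, then `|V| - |E| + |F| = ∑ (2 - 2 gᵢ) = 2 c - 2 ∑ gᵢ`. -/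
def IsToroidal {V : Type*} (G : SimpleGraph V) : Prop :=
  ∃ ρ : RotationSystem G, 2 * (Nat.card G.ConnectedComponent : ℤ) - 2 ≤ ρ.eulerChar

/-- A graph is `d`-degenerate if every (nonempty) subgraph has a vertex of degree at most `d`. -/
def IsDegenerate {V : Type*} (d : ℕ) (G : SimpleGraph V) : Prop :=
  ∀ K : G.Subgraph, K.verts.Nonempty → ∃ v ∈ K.verts, (K.neighborSet v).encard ≤ d

/-- `G` is `(d, h)`-decomposable if it has a subgraph `H` of maximum degree at most `h` such that
`G - E(H)` is `d`-degenerate. -/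
def IsDecomposable {V : Type*} (d h : ℕ) (G : SimpleGraph V) : Prop :=
  ∃ H : G.Subgraph, (∀ v ∈ H.verts, (H.neighborSet v).encard ≤ h) ∧
    IsDegenerate d (G.deleteEdges H.edgeSet)

/-- A 4-cycle `0 1 2 3` with a chord. -/
def chordedC4 : SimpleGraph (Fin 4) :=
  SimpleGraph.fromEdgeSet {s(0, 1), s(1, 2), s(2, 3), s(3, 0), s(0, 2)}

/-- A 5-cycle `0 1 2 3 4` with a chord. -/
def chordedC5 : SimpleGraph (Fin 5) :=
  SimpleGraph.fromEdgeSet {s(0, 1), s(1, 2), s(2, 3), s(3, 4), s(4, 0), s(0, 2)}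

/-- A 6-cycle `0 1 2 3 4 5` with a chord joining two opposite vertices. -/
def chordedC6 : SimpleGraph (Fin 6) :=
  SimpleGraph.fromEdgeSet
    {s(0, 1), s(1, 2), s(2, 3), s(3, 4), s(4, 5), s(5, 0), s(0, 3)}

/-- A 6-cycle `0 1 2 3 4 5` with a triangle `0 1 6` attached on the edge `0 1`. -/
def triangleOnC6 : SimpleGraph (Fin 7) :=
  SimpleGraph.fromEdgeSet
    {s(0, 1), s(1, 2), s(2, 3), s(3, 4), s(4, 5), s(5, 0), s(0, 6), s(6, 1)}

/-- A 5-cycle `0 1 2 3 4` with a triangle `1 2 5` and a 4-cycle `0 1 6 7` attached on the two edges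
`1 2` and `0 1`, which share a vertex. -/
def triangleSquareOnC5Adj : SimpleGraph (Fin 8) :=
  SimpleGraph.fromEdgeSet
    {s(0, 1), s(1, 2), s(2, 3), s(3, 4), s(4, 0), s(1, 5), s(5, 2), s(1, 6), s(6, 7), s(7, 0)}

/-- A 5-cycle `0 1 2 3 4` with a triangle `2 3 5` and a 4-cycle `0 1 6 7` attached on the two edges
`2 3` and `0 1`, which share no vertex. -/
def triangleSquareOnC5Disj : SimpleGraph (Fin 8) :=
  SimpleGraph.fromEdgeSet
    {s(0, 1), s(1, 2), s(2, 3), s(3, 4), s(4, 0), s(2, 5), s(5, 3), s(1, 6), s(6, 7), s(7, 0)}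

/-- `G` has no (not necessarily induced) subgraph isomorphic to one of the six configurations. -/
def AvoidsConfigurations {V : Type*} (G : SimpleGraph V) : Prop :=
  chordedC4.Free G ∧ chordedC5.Free G ∧ chordedC6.Free G ∧ triangleOnC6.Free G ∧
    triangleSquareOnC5Adj.Free G ∧ triangleSquareOnC5Disj.Free G

/-- `G` contains no cycle of length `l`. -/
def HasNoCycleOfLength {V : Type*} (l : ℕ) (G : SimpleGraph V) : Prop :=
  ∀ (v : V) (c : G.Walk v v), c.IsCycle → c.length ≠ l

end ToroidalDecomposition

/-!
A vertex sequence is reducible if its vertices, some of them matched along edges, can be deleted one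
by one so that each has at most two remaining neighbours other than its partner; deleting such a
sequence reduces the theorem to a smaller graph. A minimal counterexample avoids the configurations
and has no reducible sequence.

Let each dart of its rotation system carry the charges `6 - 24 / valency` and `6 - 24 / faceLength`.
By Euler's formula for genus at most one their sum is at most zero. Faces of length at least five
give charge to the vertices of degree three and to the adjacent triangles, and vertices of degree at
least five give charge to their faces, after which, suitably averaged, no charge is negative. Hence
all of them vanish, which forces degrees at most four and faces of length four and five only. Then
some vertex of degree three lies on one face of length four and two of length five, and these three
faces contain a reducible sequence.
-/

namespace ToroidalDecomposition

/-! ### The forbidden configurations -/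

section Configurations

variable {V : Type*} {G : SimpleGraph V}

theorem fromEdgeSet_isContained (l : List V) (hl : l.Nodup) {s : Set (Sym2 (Fin l.length))}
    (h : ∀ e ∈ s, Sym2.map l.get e ∈ G.edgeSet) : (SimpleGraph.fromEdgeSet s).IsContained G :=
  ⟨⟨⟨l.get, fun hab ↦ h _ ((SimpleGraph.fromEdgeSet_adj s).1 hab).1⟩, hl.injective_get⟩⟩

theorem cycleGraph_isContained {n : ℕ} (f : Fin (n + 2) → V) (hf : (List.ofFn f).Nodup)
    (h : ∀ i, G.Adj (f i) (f (i + 1))) : (SimpleGraph.cycleGraph (n + 2)).IsContained G := by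
  refine ⟨⟨⟨f, fun {a b} hab ↦ ?_⟩, List.nodup_ofFn.1 hf⟩⟩
  rcases SimpleGraph.cycleGraph_adj.1 hab with hstep | hstep
  · rw [sub_eq_iff_eq_add'.1 hstep]
    exact (h b).symm
  · rw [sub_eq_iff_eq_add'.1 hstep]
    exact h a

theorem HasNoCycleOfLength.free_of_isContained {n : ℕ} (hG : HasNoCycleOfLength n G) (hn : 2 < n)
    {W : Type*} {K : SimpleGraph W} (hK : (SimpleGraph.cycleGraph n).IsContained K) :
    K.Free G := by
  intro hKG
  obtain ⟨v, c, hc, hlen⟩ := (SimpleGraph.cycleGraph_isContained_iff hn).1 (hK.trans hKG)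
  exact hG v c hc hlen

theorem HasNoCycleOfLength.chordedC6_free_of_four (hG : HasNoCycleOfLength 4 G) :
    chordedC6.Free G :=
  hG.free_of_isContained (by simp) <| cycleGraph_isContained ![0, 1, 2, 3] (by decide)
    (by simp [chordedC6, Fin.forall_fin_succ])

theorem HasNoCycleOfLength.chordedC6_free_of_six (hG : HasNoCycleOfLength 6 G) :
    chordedC6.Free G :=
  hG.free_of_isContained (by simp) <| cycleGraph_isContained ![0, 1, 2, 3, 4, 5] (by decide)
    (by simp [chordedC6, Fin.forall_fin_succ])

theorem HasNoCycleOfLength.triangleOnC6_free_of_six (hG : HasNoCycleOfLength 6 G) :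
    triangleOnC6.Free G :=
  hG.free_of_isContained (by simp) <| cycleGraph_isContained ![0, 1, 2, 3, 4, 5] (by decide)
    (by simp [triangleOnC6, Fin.forall_fin_succ])

theorem HasNoCycleOfLength.triangleOnC6_free_of_seven (hG : HasNoCycleOfLength 7 G) :
    triangleOnC6.Free G :=
  hG.free_of_isContained (by simp) <| cycleGraph_isContained ![0, 6, 1, 2, 3, 4, 5] (by decide)
    (by simp [triangleOnC6, Fin.forall_fin_succ])

theorem HasNoCycleOfLength.avoidsConfigurations_of_three (hG : HasNoCycleOfLength 3 G)
    (hC6 : chordedC6.Free G) : AvoidsConfigurations G := by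
  refine ⟨?_, ?_, hC6, ?_, ?_, ?_⟩ <;> refine hG.free_of_isContained (by simp) ?_
  · exact cycleGraph_isContained ![0, 1, 2] (by decide) (by simp [chordedC4, Fin.forall_fin_succ])
  · exact cycleGraph_isContained ![0, 1, 2] (by decide) (by simp [chordedC5, Fin.forall_fin_succ])
  · exact cycleGraph_isContained ![0, 1, 6] (by decide)
      (by simp [triangleOnC6, Fin.forall_fin_succ])
  · exact cycleGraph_isContained ![1, 2, 5] (by decide)
      (by simp [triangleSquareOnC5Adj, Fin.forall_fin_succ])
  · exact cycleGraph_isContained ![2, 3, 5] (by decide)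
      (by simp [triangleSquareOnC5Disj, Fin.forall_fin_succ])

theorem HasNoCycleOfLength.avoidsConfigurations_of_four (hG : HasNoCycleOfLength 4 G)
    (hC6 : triangleOnC6.Free G) : AvoidsConfigurations G := by
  refine ⟨?_, ?_, hG.chordedC6_free_of_four, hC6, ?_, ?_⟩ <;>
    refine hG.free_of_isContained (by simp) ?_
  · exact cycleGraph_isContained ![0, 1, 2, 3] (by decide)
      (by simp [chordedC4, Fin.forall_fin_succ])
  · exact cycleGraph_isContained ![0, 2, 3, 4] (by decide)
      (by simp [chordedC5, Fin.forall_fin_succ])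
  · exact cycleGraph_isContained ![0, 1, 6, 7] (by decide)
      (by simp [triangleSquareOnC5Adj, Fin.forall_fin_succ])
  · exact cycleGraph_isContained ![0, 1, 6, 7] (by decide)
      (by simp [triangleSquareOnC5Disj, Fin.forall_fin_succ])

theorem avoidsConfigurations_of_hasNoCycleOfLength {i j : ℕ}
    (hij : (i, j) ∈ ({(3, 4), (3, 6), (4, 6), (4, 7)} : Set (ℕ × ℕ)))
    (hi : HasNoCycleOfLength i G) (hj : HasNoCycleOfLength j G) : AvoidsConfigurations G := by
  simp only [Set.mem_insert_iff, Set.mem_singleton_iff, Prod.mk.injEq] at hij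
  rcases hij with ⟨rfl, rfl⟩ | ⟨rfl, rfl⟩ | ⟨rfl, rfl⟩ | ⟨rfl, rfl⟩
  · exact hi.avoidsConfigurations_of_three hj.chordedC6_free_of_four
  · exact hi.avoidsConfigurations_of_three hj.chordedC6_free_of_six
  · exact hi.avoidsConfigurations_of_four hj.triangleOnC6_free_of_six
  · exact hi.avoidsConfigurations_of_four hj.triangleOnC6_free_of_seven

theorem AvoidsConfigurations.anti {H : SimpleGraph V} (hle : H ≤ G)
    (h : AvoidsConfigurations G) : AvoidsConfigurations H :=
  have free_of_le {n : ℕ} {K : SimpleGraph (Fin n)} (hK : K.Free G) : K.Free H :=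
    fun hKH ↦ hK (hKH.mono_right hle)
  ⟨free_of_le h.1, free_of_le h.2.1, free_of_le h.2.2.1, free_of_le h.2.2.2.1,
    free_of_le h.2.2.2.2.1, free_of_le h.2.2.2.2.2⟩

end Configurations


/-! ### Reducible sequences -/

section Reduction

variable {V : Type*} {G : SimpleGraph V} {d : ℕ}

theorem isDegenerate_iff :
    IsDegenerate d G ↔ ∀ S : Set V, S.Nonempty → ∃ v ∈ S, (S ∩ G.neighborSet v).encard ≤ d := by
  constructor
  · intro hG S hS
    obtain ⟨v, hv, hcard⟩ := hG ((⊤ : G.Subgraph).induce S) hS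
    refine ⟨v, hv, (Set.encard_le_encard ?_).trans hcard⟩
    exact fun w hw ↦ ⟨hv, hw.1, hw.2⟩
  · intro hG K hK
    obtain ⟨v, hv, hcard⟩ := hG K.verts hK
    refine ⟨v, hv, (Set.encard_le_encard ?_).trans hcard⟩
    exact fun w hw ↦ ⟨K.edge_vert (K.adj_symm hw), K.adj_sub hw⟩

theorem isDecomposable_iff {k : ℕ} :
    IsDecomposable d k G ↔
      ∃ M ≤ G, (∀ v, (M.neighborSet v).encard ≤ k) ∧ IsDegenerate d (G \ M) := by
  constructor
  · rintro ⟨H, hH, hdeg⟩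
    refine ⟨H.spanningCoe, H.spanningCoe_le, fun v ↦ ?_, ?_⟩
    · by_cases hv : v ∈ H.verts
      · exact hH v hv
      · have hempty : H.spanningCoe.neighborSet v = ∅ :=
          Set.eq_empty_of_forall_notMem fun w hw ↦ hv (H.edge_vert hw)
        simp [hempty]
    · convert hdeg using 1
      ext v w
      simp
  · rintro ⟨M, hMG, hM, hdeg⟩
    refine ⟨SimpleGraph.toSubgraph M hMG, fun v _ ↦ hM v, ?_⟩
    convert hdeg using 1
    ext v w
    simp

/-- A sequence `x` of distinct vertices, partially matched by the involution `m` (the fixed points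
of `m` are unmatched), in which every vertex has at most `d` neighbours apart from its partner and
the later vertices. Any `(d, 1)`-decomposition of the remaining graph extends to such a sequence. -/
structure ReducibleSequence (d : ℕ) (G : SimpleGraph V) {n : ℕ} (x : Fin n → V)
    (m : Fin n → Fin n) : Prop where
  injective : Function.Injective x
  involutive : Function.Involutive m
  adj : ∀ i, m i ≠ i → G.Adj (x i) (x (m i))
  encard_le : ∀ i, {w | G.Adj (x i) w ∧ ∀ j, x j = w → j ≠ m i ∧ j ≤ i}.encard ≤ d

/-- The graph has a reducible sequence that meets an edge. -/
def HasReducible (d : ℕ) (G : SimpleGraph V) : Prop :=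
  ∃ (n : ℕ) (x : Fin n → V) (m : Fin n → Fin n), ReducibleSequence d G x m ∧ ∃ i w, G.Adj (x i) w

namespace ReducibleSequence

variable {n : ℕ} {x : Fin n → V} {m : Fin n → Fin n}

/-- The matching that joins the partners in a reducible sequence. -/
def matching (h : ReducibleSequence d G x m) : SimpleGraph V where
  Adj a b := ∃ i, m i ≠ i ∧ x i = a ∧ x (m i) = b
  symm := ⟨by
    rintro _ _ ⟨i, hi, rfl, rfl⟩
    exact ⟨m i, by rw [h.involutive]; exact hi.symm, rfl, by rw [h.involutive]⟩⟩
  loopless := ⟨fun _ ⟨_, hi, ha, hb⟩ ↦ hi (h.injective (hb.trans ha.symm))⟩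

theorem matching_le (h : ReducibleSequence d G x m) : h.matching ≤ G := by
  rintro _ _ ⟨i, hi, rfl, rfl⟩
  exact h.adj i hi

theorem encard_neighborSet_sup_le (h : ReducibleSequence d G x m) {M : SimpleGraph V}
    (hM : ∀ v, (M.neighborSet v).encard ≤ 1) (hx : ∀ i w, ¬ M.Adj (x i) w) (v : V) :
    ((M ⊔ h.matching).neighborSet v).encard ≤ 1 := by
  by_cases hv : ∃ i, x i = v
  · obtain ⟨i, rfl⟩ := hv
    refine (Set.encard_le_encard (t := {x (m i)}) ?_).trans (Set.encard_singleton _).le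
    rintro w (hw | ⟨j, -, hj, rfl⟩)
    · exact absurd hw (hx i w)
    · rw [h.injective hj]
      rfl
  · refine (Set.encard_le_encard ?_).trans (hM v)
    rintro w (hw | ⟨i, -, hi, -⟩)
    · exact hw
    · exact absurd ⟨i, hi⟩ hv

theorem isDegenerate_sdiff_sup (h : ReducibleSequence d G x m) {M : SimpleGraph V}
    (hM : IsDegenerate d (G.deleteEdges {e | ∃ i, x i ∈ e} \ M)) :
    IsDegenerate d (G \ (M ⊔ h.matching)) := by
  rw [isDegenerate_iff] at hM ⊢
  intro S hS
  by_cases hxS : ∃ i, x i ∈ S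
  · classical
    obtain ⟨i, hi, hmax⟩ := (Finset.univ.filter fun i ↦ x i ∈ S).exists_max_image id
      (by simpa [Finset.filter_nonempty_iff] using hxS)
    simp only [Finset.mem_filter, Finset.mem_univ, true_and, id] at hi hmax
    refine ⟨x i, hi, (Set.encard_le_encard ?_).trans (h.encard_le i)⟩
    rintro w ⟨hwS, hadj, hw⟩
    refine ⟨hadj, ?_⟩
    rintro j rfl
    refine ⟨?_, hmax j hwS⟩
    rintro rfl
    exact hw (Or.inr ⟨i, fun hmi ↦ hadj.ne (by rw [hmi]), rfl, rfl⟩)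
  · obtain ⟨v, hv, hcard⟩ := hM S hS
    refine ⟨v, hv, (Set.encard_le_encard ?_).trans hcard⟩
    rintro w ⟨hwS, hadj, hw⟩
    refine ⟨hwS, SimpleGraph.deleteEdges_adj.2 ⟨hadj, ?_⟩, fun hMw ↦ hw (Or.inl hMw)⟩
    rintro ⟨i, hi⟩
    rcases Sym2.mem_iff.1 hi with hi | hi
    · exact hxS ⟨i, hi ▸ hv⟩
    · exact hxS ⟨i, hi ▸ hwS⟩

theorem isDecomposable (h : ReducibleSequence d G x m)
    (hG : IsDecomposable d 1 (G.deleteEdges {e | ∃ i, x i ∈ e})) : IsDecomposable d 1 G := by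
  rw [isDecomposable_iff] at hG ⊢
  obtain ⟨M, hMG, hM, hdeg⟩ := hG
  refine ⟨M ⊔ h.matching, sup_le (hMG.trans (SimpleGraph.deleteEdges_le _)) h.matching_le,
    h.encard_neighborSet_sup_le hM fun i w hw ↦ ?_, h.isDegenerate_sdiff_sup hdeg⟩
  exact (SimpleGraph.deleteEdges_adj.1 (hMG hw)).2 ⟨i, Sym2.mem_mk_left _ _⟩

end ReducibleSequence

theorem isDecomposable_bot : IsDecomposable d 1 (⊥ : SimpleGraph V) :=
  isDecomposable_iff.2 ⟨⊥, le_rfl, by simp, isDegenerate_iff.2 fun _ ⟨v, hv⟩ ↦ ⟨v, hv, by simp⟩⟩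

theorem isDecomposable_of_hasReducible [Finite V]
    (hred : ∀ H ≤ G, H ≠ ⊥ → HasReducible d H) : IsDecomposable d 1 G := by
  induction G using WellFoundedLT.induction with
  | ind G ih =>
    rcases eq_or_ne G ⊥ with rfl | hG
    · exact isDecomposable_bot
    obtain ⟨n, x, m, hx, i, w, hadj⟩ := hred G le_rfl hG
    have hle := G.deleteEdges_le {e | ∃ i, x i ∈ e}
    refine hx.isDecomposable (ih _ (hle.lt_of_not_ge fun hge ↦ ?_)
      fun H hH ↦ hred H (hH.trans hle))
    exact (SimpleGraph.deleteEdges_adj.1 (hge hadj)).2 ⟨i, Sym2.mem_mk_left _ _⟩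

/-- The number of neighbours of a vertex. -/
noncomputable def valency (G : SimpleGraph V) (v : V) : ℕ := (G.neighborSet v).ncard

theorem length_le_valency [Finite V] {v : V} {l : List V} (hl : l.Nodup) (h : ∀ w ∈ l, G.Adj v w) :
    l.length ≤ valency G v := by
  classical
  rw [← List.toFinset_card_of_nodup hl, ← Set.ncard_coe_finset]
  exact Set.ncard_le_ncard fun w hw ↦ h w (List.mem_toFinset.1 hw)

theorem hasReducible_of_later [Finite V] {n : ℕ} {x : Fin (n + 1) → V}
    {m : Fin (n + 1) → Fin (n + 1)} (L : Fin (n + 1) → Finset (Fin (n + 1)))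
    (hx : (List.ofFn x).Nodup) (hm : ∀ i, m (m i) = i) (hL : ∀ i, ∀ j ∈ L i, j = m i ∨ i < j)
    (hne : (L 0).Nonempty) (hadj : ∀ i, m i ≠ i → G.Adj (x i) (x (m i)))
    (hadjL : ∀ i, ∀ j ∈ L i, G.Adj (x i) (x j)) (hval : ∀ i, valency G (x i) ≤ d + (L i).card) :
    HasReducible d G := by
  have hinj : Function.Injective x := List.nodup_ofFn.1 hx
  refine ⟨n + 1, x, m, ⟨hinj, hm, hadj, fun i ↦ ?_⟩, 0, _, hadjL 0 _ hne.choose_spec⟩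
  have hsub : x '' L i ⊆ G.neighborSet (x i) := by
    rintro _ ⟨j, hj, rfl⟩
    exact hadjL i j hj
  have hrest : {w | G.Adj (x i) w ∧ ∀ j, x j = w → j ≠ m i ∧ j ≤ i} ⊆
      G.neighborSet (x i) \ x '' L i := by
    rintro w ⟨hw, hlater⟩
    refine ⟨hw, ?_⟩
    rintro ⟨j, hj, rfl⟩
    obtain ⟨hjm, hji⟩ := hlater j rfl
    exact (hL i j hj).elim hjm hji.not_gt
  have hcard := Set.ncard_sdiff_add_ncard_of_subset hsub (Set.toFinite _)
  rw [Set.ncard_image_of_injective _ hinj, Set.ncard_coe_finset] at hcard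
  have hval := hval i
  rw [valency] at hval
  refine (Set.encard_le_encard hrest).trans ?_
  rw [← (Set.toFinite _).cast_ncard_eq]
  exact_mod_cast (by omega : _ ≤ d)

theorem hasReducible_of_valency_le [Finite V] {u v : V} (huv : G.Adj u v)
    (hu : valency G u ≤ d) : HasReducible d G := by
  refine ⟨1, fun _ ↦ u, id, ⟨Function.injective_of_subsingleton _, fun _ ↦ rfl,
    fun _ h ↦ absurd rfl h, fun _ ↦ ?_⟩, 0, v, huv⟩
  refine (Set.encard_le_encard fun w hw ↦ hw.1).trans (b := (G.neighborSet u).encard) ?_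
  rw [← (Set.toFinite _).cast_ncard_eq]
  exact_mod_cast hu

end Reduction


section ReducibleConfigurations

variable {V : Type*} {G : SimpleGraph V}

/-- The vertices `a, b, c, d, e` form a 5-cycle, in this order. -/
structure Pentagon (G : SimpleGraph V) (a b c d e : V) : Prop where
  nodup : [a, b, c, d, e].Nodup
  ab : G.Adj a b
  bc : G.Adj b c
  cd : G.Adj c d
  de : G.Adj d e
  ea : G.Adj e a

theorem Pentagon.rotate {a b c d e : V} (P : Pentagon G a b c d e) : Pentagon G b c d e a :=
  ⟨(List.nodup_rotate (n := 1)).2 P.nodup, P.bc, P.cd, P.de, P.ea, P.ab⟩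

theorem Pentagon.reverse {a b c d e : V} (P : Pentagon G a b c d e) : Pentagon G e d c b a :=
  ⟨List.nodup_reverse.2 P.nodup, P.de.symm, P.cd.symm, P.bc.symm, P.ab.symm, P.ea.symm⟩

/-- The vertices `a, b, c, d` form a 4-cycle, in this order. -/
structure Square (G : SimpleGraph V) (a b c d : V) : Prop where
  nodup : [a, b, c, d].Nodup
  ab : G.Adj a b
  bc : G.Adj b c
  cd : G.Adj c d
  da : G.Adj d a

theorem Square.rotate {a b c d : V} (S : Square G a b c d) : Square G b c d a :=
  ⟨(List.nodup_rotate (n := 1)).2 S.nodup, S.bc, S.cd, S.da, S.ab⟩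

theorem Square.swap {a b c d : V} (S : Square G a b c d) : Square G b a d c :=
  ⟨by grind [S.nodup], S.ab.symm, S.da.symm, S.cd.symm, S.bc.symm⟩

variable [Finite V]

theorem hasReducible_of_adj {u v : V} (huv : G.Adj u v) (hu : valency G u ≤ 3)
    (hv : valency G v ≤ 3) : HasReducible 2 G := by
  refine hasReducible_of_later (x := ![u, v]) (m := ![1, 0]) ![{1}, {0}] ?_ (by decide) (by decide)
    (by decide) ?_ ?_ ?_
  · simpa using huv.ne
  all_goals simp [Fin.forall_fin_succ, huv, huv.symm, hu, hv]

theorem Square.hasReducible {a b c d : V} (S : Square G a b c d) (ha : valency G a ≤ 3)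
    (hb : valency G b ≤ 4) (hc : valency G c ≤ 3) (hd : valency G d ≤ 4) : HasReducible 2 G := by
  obtain ⟨hn, hab, hbc, hcd, hda⟩ := S
  refine hasReducible_of_later (x := ![b, d, a, c]) (m := ![2, 3, 0, 1])
    ![{2, 3}, {2, 3}, {0}, {1}] ?_ (by decide) (by decide) (by decide) ?_ ?_ ?_ <;>
  simp [Fin.forall_fin_succ] <;> grind [G.adj_comm]

theorem hasReducible_of_triangle_edge {a b c x : V} (hn : [a, b, c, x].Nodup) (hab : G.Adj a b)
    (hbc : G.Adj b c) (hax : G.Adj a x) (hxb : G.Adj x b) (ha : valency G a ≤ 3)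
    (hb : valency G b ≤ 4) (hc : valency G c ≤ 3) (hx : valency G x ≤ 4) : HasReducible 2 G := by
  refine hasReducible_of_later (x := ![c, x, b, a]) (m := ![2, 3, 0, 1])
    ![{2}, {2, 3}, {0, 3}, {1}] ?_ (by decide) (by decide) (by decide) ?_ ?_ ?_ <;>
  simp [Fin.forall_fin_succ] <;> grind [G.adj_comm]

theorem Pentagon.hasReducible_of_triangle_ad {a b c d e x : V} (P : Pentagon G a b c d e)
    (hx : x ∉ [a, b, c, d, e]) (hax : G.Adj a x) (hxb : G.Adj x b) (va : valency G a ≤ 3)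
    (vb : valency G b ≤ 4) (vc : valency G c ≤ 4) (vd : valency G d ≤ 3) (ve : valency G e ≤ 4)
    (vx : valency G x ≤ 4) : HasReducible 2 G := by
  obtain ⟨hn, hab, hbc, hcd, hde, hea⟩ := P
  refine hasReducible_of_later (x := ![x, b, c, e, d, a]) (m := ![5, 2, 1, 4, 3, 0])
    ![{5, 1}, {2, 5}, {1, 4}, {4, 5}, {3}, {0}] ?_ (by decide) (by decide) (by decide) ?_ ?_ ?_ <;>
  simp [Fin.forall_fin_succ] <;> grind [G.adj_comm]

theorem Pentagon.hasReducible_of_triangle_ce {a b c d e x : V} (P : Pentagon G a b c d e)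
    (hx : x ∉ [a, b, c, d, e]) (hax : G.Adj a x) (hxb : G.Adj x b) (va : valency G a ≤ 4)
    (vb : valency G b ≤ 4) (vc : valency G c ≤ 3) (vd : valency G d ≤ 4) (ve : valency G e ≤ 3)
    (vx : valency G x ≤ 4) : HasReducible 2 G := by
  obtain ⟨hn, hab, hbc, hcd, hde, hea⟩ := P
  refine hasReducible_of_later (x := ![x, b, a, d, c, e]) (m := ![2, 4, 0, 5, 1, 3])
    ![{2, 1}, {4, 2}, {0, 5}, {5, 4}, {1}, {3}] ?_ (by decide) (by decide) (by decide) ?_ ?_ ?_ <;>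
  simp [Fin.forall_fin_succ] <;> grind [G.adj_comm]

/-- The pentagons `h b c d e` and `h e f k g` share the edge `h e`, the 4-cycle `h b a g` closes up
around `h`, and every vertex has valency at most 4, and `h` at most 3. -/
structure Hub (G : SimpleGraph V) (h a b c d e f k g : V) : Prop where
  nodup : [h, a, b, c, d, e, f, k, g].Nodup
  left : Pentagon G h b c d e
  right : Pentagon G h e f k g
  ab : G.Adj a b
  ga : G.Adj g a
  valency_le_three : valency G h ≤ 3
  valency_le_four : ∀ v ∈ [a, b, c, d, e, f, k, g], valency G v ≤ 4

theorem Hub.hasReducible {h a b c d e f k g : V} (H : Hub G h a b c d e f k g)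
    (hcd3 : valency G c ≤ 3 ∨ valency G d ≤ 3) (hfk3 : valency G f ≤ 3 ∨ valency G k ≤ 3) :
    HasReducible 2 G := by
  obtain ⟨hn, ⟨-, hhb, hbc, hcd, hde, heh⟩, ⟨-, -, hef, hfk, hkg, hgh⟩, hab, hga, vh, hv⟩ := H
  simp only [List.forall_mem_cons] at hv
  rcases hcd3 with h1 | h1 <;> rcases hfk3 with h2 | h2
  · refine hasReducible_of_later (x := ![a, b, k, g, h, e, f, d, c])
      (m := ![3, 8, 6, 0, 4, 7, 2, 5, 1])
      ![{3, 1}, {8, 4}, {6, 3}, {0, 4}, {5}, {7, 6}, {2}, {5, 8}, {1}]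
      ?_ (by decide) (by decide) (by decide) ?_ ?_ ?_ <;>
    simp [Fin.forall_fin_succ] <;> grind [G.adj_comm]
  · refine hasReducible_of_later (x := ![a, b, f, e, h, g, k, d, c])
      (m := ![5, 8, 6, 7, 4, 0, 2, 3, 1])
      ![{5, 1}, {8, 4}, {6, 3}, {7, 4}, {5}, {0, 6}, {2}, {3, 8}, {1}]
      ?_ (by decide) (by decide) (by decide) ?_ ?_ ?_ <;>
    simp [Fin.forall_fin_succ] <;> grind [G.adj_comm]
  · refine hasReducible_of_later (x := ![a, b, k, g, h, e, f, c, d])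
      (m := ![3, 7, 6, 0, 4, 8, 2, 1, 5])
      ![{3, 1}, {7, 4}, {6, 3}, {0, 4}, {5}, {8, 6}, {2}, {1, 8}, {5}]
      ?_ (by decide) (by decide) (by decide) ?_ ?_ ?_ <;>
    simp [Fin.forall_fin_succ] <;> grind [G.adj_comm]
  · refine hasReducible_of_later (x := ![a, b, f, e, h, g, k, c, d])
      (m := ![5, 7, 6, 8, 4, 0, 2, 1, 3])
      ![{5, 1}, {7, 4}, {6, 3}, {8, 4}, {5}, {0, 6}, {2}, {1, 8}, {3}]
      ?_ (by decide) (by decide) (by decide) ?_ ?_ ?_ <;>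
    simp [Fin.forall_fin_succ] <;> grind [G.adj_comm]

end ReducibleConfigurations


/-! ### Cycles of a permutation -/

section NumCycles

open Equiv Equiv.Perm Function

variable {D : Type*}

/-- The number of cycles of a permutation, fixed points included. -/
noncomputable def numCycles (f : Perm D) : ℕ := Nat.card (Quotient (SameCycle.setoid f))

variable [Finite D]

theorem eq_of_sameCycle {β : Type*} {f : Perm D} {h : D → β} (hf : ∀ x, h (f x) = h x) {x y : D}
    (hxy : f.SameCycle x y) : h x = h y := by
  obtain ⟨n, rfl⟩ := hxy.exists_nat_pow_eq
  induction n with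
  | zero => rfl
  | succ n ih => rw [pow_succ', mul_apply, hf, ih (sameCycle_pow_right.2 (.refl f x))]

theorem sameCycle_of_semiconj {D' : Type*} {f : Perm D} {g : Perm D'} {ι : D' → D}
    (hι : Injective ι) (h : Semiconj ι g f) {x y : D'} (hxy : f.SameCycle (ι x) (ι y)) :
    g.SameCycle x y := by
  obtain ⟨n, hn⟩ := hxy.exists_nat_pow_eq
  refine ⟨n, hι ?_⟩
  rw [zpow_natCast, ← hn, ← iterate_eq_pow, ← iterate_eq_pow]
  exact h.iterate_right n x

theorem card_le_numCycles_add_one {β : Type*} [Finite β] {f : Perm D} {h : D → β}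
    (hf : ∀ x, h (f x) = h x) (b : β) (hb : ∀ c ≠ b, ∃ x, h x = c) :
    Nat.card β ≤ numCycles f + 1 := by
  let onCycles : Quotient (SameCycle.setoid f) → β := Quotient.lift h fun _ _ ↦ eq_of_sameCycle hf
  have hsurj : Surjective (fun o : Option (Quotient (SameCycle.setoid f)) ↦ o.elim b onCycles) := by
    intro c
    by_cases hc : c = b
    · exact ⟨none, hc.symm⟩
    · obtain ⟨x, hx⟩ := hb c hc
      exact ⟨some (Quotient.mk _ x), hx⟩
  simpa [numCycles] using Nat.card_le_card_of_surjective _ hsurj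

theorem ncard_sameCycle (f : Perm D) (x : D) : {y | f.SameCycle x y}.ncard = minimalPeriod f x := by
  classical
  have := Fintype.ofFinite D
  have horbit : {y | f.SameCycle x y} = MulAction.orbit (Subgroup.zpowers f) x := by
    ext y
    exact ⟨fun ⟨i, hi⟩ ↦ ⟨⟨f ^ i, i, rfl⟩, hi⟩, fun ⟨⟨_, i, rfl⟩, hi⟩ ↦ ⟨i, hi⟩⟩
  rw [horbit, ← Nat.card_coe_set_eq, Nat.card_eq_fintype_card]
  exact (MulAction.minimalPeriod_eq_card f x).symm

theorem mem_periodicPts (f : Perm D) (x : D) : x ∈ periodicPts f :=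
  f.injective.mem_periodicPts x

theorem minimalPeriod_pos (f : Perm D) (x : D) : 0 < minimalPeriod f x :=
  minimalPeriod_pos_of_mem_periodicPts (mem_periodicPts f x)

theorem minimalPeriod_apply_perm (f : Perm D) (x : D) :
    minimalPeriod f (f x) = minimalPeriod f x :=
  minimalPeriod_apply (mem_periodicPts f x)

theorem sum_one_div_minimalPeriod [Fintype D] (f : Perm D) :
    ∑ x, (1 : ℚ) / minimalPeriod f x = numCycles f := by
  classical
  have := Fintype.ofFinite (Quotient (SameCycle.setoid f))
  rw [← Finset.sum_fiberwise Finset.univ (Quotient.mk (SameCycle.setoid f)), numCycles,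
    Nat.card_eq_fintype_card, ← Finset.card_univ, Finset.cast_card]
  refine Finset.sum_congr rfl fun q _ ↦ ?_
  induction q using Quotient.inductionOn with | _ y
  have hfiber : ∀ x, Quotient.mk (SameCycle.setoid f) x = Quotient.mk _ y ↔ f.SameCycle y x :=
    fun x ↦ Quotient.eq.trans sameCycle_comm
  simp only [hfiber]
  rw [Finset.sum_congr rfl (g := fun _ ↦ (1 : ℚ) / minimalPeriod f y) fun x hx ↦ ?_]
  · have hpos : (minimalPeriod f y : ℚ) ≠ 0 := by exact_mod_cast (minimalPeriod_pos f y).ne'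
    rw [Finset.sum_const, nsmul_eq_mul, ← Set.ncard_coe_finset, Finset.coe_filter_univ,
      ncard_sameCycle, mul_one_div_cancel hpos]
  · rw [eq_of_sameCycle (minimalPeriod_apply_perm f) (Finset.mem_filter.1 hx).2]

end NumCycles

section SwapMul

open Equiv Equiv.Perm

variable {D : Type*} [DecidableEq D]

theorem apply_swap_mul {β : Type*} {f : Perm D} {h : D → β} (hf : ∀ x, h (f x) = h x) {a b : D}
    (hab : h a = h b) (x : D) : h ((swap a b * f) x) = h x := by
  rw [mul_apply, ← hf x]
  by_cases ha : f x = a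
  · rw [ha, swap_apply_left, hab]
  by_cases hb : f x = b
  · rw [hb, swap_apply_right, hab]
  rw [swap_apply_of_ne_of_ne ha hb]

/-- The permutation that fixes `a` and otherwise follows `f`, skipping `a`. -/
def cutOut (f : Perm D) (a : D) : Perm D := swap a (f a) * f

theorem cutOut_self (f : Perm D) (a : D) : cutOut f a a = a := by simp [cutOut]

theorem cutOut_apply_of_eq (f : Perm D) {a x : D} (h : f x = a) : cutOut f a x = f a := by
  simp [cutOut, h]

theorem cutOut_apply_of_ne (f : Perm D) {a x : D} (hx : x ≠ a) (h : f x ≠ a) :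
    cutOut f a x = f x := by
  simp [cutOut, swap_apply_of_ne_of_ne h (fun h' ↦ hx (f.injective h'))]

variable [Finite D]

theorem sameCycle_cutOut {f : Perm D} {a x y : D} (hx : x ≠ a) (hy : y ≠ a)
    (h : f.SameCycle x y) : (cutOut f a).SameCycle x y := by
  obtain ⟨n, rfl⟩ := h.exists_nat_pow_eq
  -- At the moment when `f` passes through `a`, the permutation `cutOut f a` is already at `f a`.
  have hfollow : ∀ n : ℕ, (cutOut f a).SameCycle x
      (if (f ^ n) x = a then f a else (f ^ n) x) := by
    intro n
    induction n with
    | zero => simpa [hx] using SameCycle.refl (cutOut f a) x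
    | succ n ih =>
      rw [pow_succ', mul_apply]
      by_cases hn : (f ^ n) x = a
      · simpa [hn] using ih
      · rw [if_neg hn, ← sameCycle_apply_right] at ih
        by_cases hn' : f ((f ^ n) x) = a
        · rwa [if_pos hn', ← cutOut_apply_of_eq f hn']
        · rwa [if_neg hn', ← cutOut_apply_of_ne f hn hn']
  simpa only [if_neg hy] using hfollow n

theorem not_sameCycle_swap_mul {f : Perm D} {a b : D} (hab : a ≠ b) (h : f.SameCycle a b) :
    ¬ (swap a b * f).SameCycle a b := by
  classical
  have hex := h.exists_nat_pow_eq
  let k := Nat.find hex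
  have hk : (f ^ k) a = b := Nat.find_spec hex
  have hmin : ∀ i < k, (f ^ i) a ≠ b := fun i hi ↦ Nat.find_min hex hi
  have hk0 : 0 < k := (Nat.find_pos hex).2 hab
  -- The modified permutation keeps the segment of the cycle that runs from `a` to `b` invariant.
  have hsegment : ∀ n : ℕ, ∃ i < k, ((swap a b * f) ^ n) a = (f ^ i) a := by
    intro n
    induction n with
    | zero => exact ⟨0, hk0, rfl⟩
    | succ n ih =>
      obtain ⟨i, hi, hni⟩ := ih
      have hstep : f ((f ^ i) a) = (f ^ (i + 1)) a := by rw [pow_succ', mul_apply]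
      rw [pow_succ', mul_apply, hni, mul_apply, hstep]
      rcases (Nat.succ_le_of_lt hi).lt_or_eq with hlt | heq
      · refine ⟨i + 1, hlt, swap_apply_of_ne_of_ne (fun hcyc ↦ ?_) (hmin _ hlt)⟩
        refine hmin (k - (i + 1)) (by omega) ?_
        conv_lhs => rw [← hcyc, ← mul_apply, ← pow_add, Nat.sub_add_cancel hlt.le, hk]
      · exact ⟨0, hk0, by rw [← Nat.succ_eq_add_one, heq, hk, swap_apply_right]; rfl⟩
  intro hsame
  obtain ⟨n, hn⟩ := hsame.exists_nat_pow_eq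
  obtain ⟨i, hi, hni⟩ := hsegment n
  exact hmin i hi (hni.symm.trans hn)

theorem numCycles_add_one_le_swap_mul {f : Perm D} {a b : D} (h : f.SameCycle a b) :
    numCycles f + 1 ≤ numCycles (swap a b * f) + if a = b then 1 else 0 := by
  by_cases hab : a = b
  · rw [hab, swap_self, if_pos rfl]
    rfl
  have hinv : ∀ x, Quotient.mk (SameCycle.setoid f) ((swap a b * f) x) = Quotient.mk _ x :=
    apply_swap_mul (fun x ↦ Quotient.sound (sameCycle_apply_left.2 (.refl f x))) (Quotient.sound h)
  let merge : Quotient (SameCycle.setoid (swap a b * f)) → Quotient (SameCycle.setoid f) :=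
    Quotient.lift (Quotient.mk _) fun _ _ ↦ eq_of_sameCycle hinv
  have hsurj : merge.Surjective := by
    rintro ⟨x⟩
    exact ⟨Quotient.mk _ x, rfl⟩
  rw [if_neg hab]
  refine Nat.succ_le_of_lt (lt_of_not_ge fun hle ↦ not_sameCycle_swap_mul hab h ?_)
  have hmerge : merge (Quotient.mk _ a) = merge (Quotient.mk _ b) := Quotient.sound h
  exact Quotient.exact ((hsurj.bijective_of_nat_card_le hle).1 hmerge)

theorem numCycles_le_swap_mul_add_one (f : Perm D) (a b : D) :
    numCycles f ≤ numCycles (swap a b * f) + 1 := by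
  classical
  -- Send the whole cycle of `b` to the cycle of `a`.
  let g : D → Quotient (SameCycle.setoid f) := fun x ↦
    if f.SameCycle x b then Quotient.mk _ a else Quotient.mk _ x
  have hgf : ∀ x, g (f x) = g x := by
    intro x
    simp only [g, sameCycle_apply_left]
    split_ifs
    · rfl
    · exact Quotient.sound (sameCycle_apply_left.2 (.refl f x))
  have hgab : g a = g b := by simp [g, SameCycle.refl]
  refine card_le_numCycles_add_one (apply_swap_mul hgf hgab) (Quotient.mk _ b) ?_
  rintro ⟨x⟩ hx
  exact ⟨x, if_neg fun hxb ↦ hx (Quotient.sound hxb)⟩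

end SwapMul


/-! ### Subgraphs of toroidal graphs -/

section EdgeDeletion

open Equiv Equiv.Perm SimpleGraph

variable {V : Type*} {G : SimpleGraph V}

instance finite_dart [Finite V] : Finite G.Dart := .of_injective _ Dart.toProd_injective

theorem eq_of_reachable_of_deleteEdges {β : Type*} {h : V → β} {u v x y : V}
    (hh : ∀ x y, (G.deleteEdges {s(u, v)}).Adj x y → h x = h y) (huv : h u = h v)
    (hxy : G.Reachable x y) : h x = h y := by
  obtain ⟨p⟩ := hxy
  induction p with
  | nil => rfl
  | @cons a b _ hab _ ih =>
    rw [← ih]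
    by_cases he : s(a, b) = s(u, v)
    · rcases Sym2.eq_iff.1 he with ⟨rfl, rfl⟩ | ⟨rfl, rfl⟩
      exacts [huv, huv.symm]
    · exact hh a b (deleteEdges_adj.2 ⟨hab, he⟩)

theorem card_connectedComponent_deleteEdges_le [Finite V] (u v : V) :
    Nat.card (G.deleteEdges {s(u, v)}).ConnectedComponent ≤ Nat.card G.ConnectedComponent + 1 := by
  classical
  set G' := G.deleteEdges {s(u, v)}
  -- Send the whole component of `u` to the component of `v`.
  let h : V → G'.ConnectedComponent := fun x ↦
    if G'.Reachable x u then G'.connectedComponentMk v else G'.connectedComponentMk x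
  have hh : ∀ x y, G'.Adj x y → h x = h y := by
    intro x y hxy
    have hiff : G'.Reachable x u ↔ G'.Reachable y u :=
      ⟨hxy.reachable.symm.trans, hxy.reachable.trans⟩
    simp only [h, hiff, ConnectedComponent.sound hxy.reachable]
  have huv : h u = h v := by simp [h]
  let F : Option G.ConnectedComponent → G'.ConnectedComponent := fun o ↦
    o.elim (G'.connectedComponentMk u)
      (ConnectedComponent.lift h fun _ _ p _ ↦ eq_of_reachable_of_deleteEdges hh huv ⟨p⟩)
  have hF : Function.Surjective F := by
    intro c
    induction c using ConnectedComponent.ind with | _ x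
    by_cases hx : G'.Reachable x u
    · exact ⟨none, (ConnectedComponent.sound hx).symm⟩
    · exact ⟨some (G.connectedComponentMk x), if_neg hx⟩
  simpa only [Finite.card_option] using Nat.card_le_card_of_surjective F hF

theorem card_connectedComponent_deleteEdges_le_of_reachable [Finite V] {u v : V}
    (h : (G.deleteEdges {s(u, v)}).Reachable u v) :
    Nat.card (G.deleteEdges {s(u, v)}).ConnectedComponent ≤ Nat.card G.ConnectedComponent := by
  refine Nat.card_le_card_of_surjective (ConnectedComponent.lift (connectedComponentMk _)
    fun _ _ p _ ↦ eq_of_reachable_of_deleteEdges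
      (fun x y hxy ↦ ConnectedComponent.sound hxy.reachable) (ConnectedComponent.sound h) ⟨p⟩) ?_
  intro c
  induction c using ConnectedComponent.ind with | _ x
  exact ⟨G.connectedComponentMk x, rfl⟩

namespace RotationSystem

variable (ρ : RotationSystem G)

theorem facePerm_apply (d : G.Dart) : ρ.facePerm d = ρ.next d.symm := rfl

theorem facePerm_symm_apply (d : G.Dart) : ρ.facePerm d.symm = ρ.next d := rfl

theorem facePerm_fst (d : G.Dart) : (ρ.facePerm d).fst = d.snd := ρ.next_fst d.symm

theorem next_ne_of_fst_ne {d e : G.Dart} (h : d.fst ≠ e.fst) : ρ.next d ≠ e := by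
  rintro rfl
  exact h (ρ.next_fst d).symm

theorem reachable_of_not_sameCycle [Finite V] (d : G.Dart)
    (h : ¬ ρ.facePerm.SameCycle d d.symm) :
    (G.deleteEdges {s(d.fst, d.snd)}).Reachable d.fst d.snd := by
  by_contra hd
  -- The rest of the face of `d` leads from `d.snd` back to `d.fst`.
  have hface : ∀ n : ℕ, (G.deleteEdges {s(d.fst, d.snd)}).Reachable d.snd
      ((ρ.facePerm ^ n) (ρ.facePerm d)).fst := by
    intro n
    induction n with
    | zero => rw [pow_zero, one_apply, facePerm_fst]
    | succ n ih =>
      refine ih.trans (Adj.reachable ?_)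
      rw [pow_succ', mul_apply, facePerm_fst, deleteEdges_adj]
      refine ⟨Dart.adj _, fun he ↦ ?_⟩
      rcases (dart_edge_eq_iff _ d).1 he with he | he
      · exact hd (he ▸ ih).symm
      · exact h ⟨(n + 1 : ℕ), by rw [zpow_natCast, pow_succ, mul_apply, he]⟩
  obtain ⟨n, hn⟩ := (sameCycle_apply_left.2 (.refl ρ.facePerm d)).exists_nat_pow_eq
  exact hd (hn ▸ hface n).symm

/-- The number (zero or one) of isolated vertices that the deletion of the edge of `d` creates at
the initial vertex of `d`. -/
noncomputable def pendant (d : G.Dart) : ℕ := by classical exact if d = ρ.next d then 1 else 0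

theorem pendant_eq [DecidableEq G.Dart] (d : G.Dart) :
    ρ.pendant d = if d = ρ.next d then 1 else 0 := by
  rw [pendant]
  congr

theorem not_adj_deleteEdges_of_next_eq {d : G.Dart} (h : d = ρ.next d) (w : V) :
    ¬ (G.deleteEdges {s(d.fst, d.snd)}).Adj d.fst w := by
  rw [deleteEdges_adj]
  rintro ⟨hw, hne⟩
  obtain ⟨i, hi⟩ := ρ.sameCycle_of_fst_eq d ⟨(d.fst, w), hw⟩ rfl
  rw [zpow_apply_eq_self_of_apply_eq_self h.symm] at hi
  exact hne (by rw [hi]; rfl)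

theorem card_isolated_add_pendant_le [Finite V] (d : G.Dart) :
    Nat.card {v : V // ∀ w, ¬ G.Adj v w} + ρ.pendant d + ρ.pendant d.symm ≤
      Nat.card {v : V // ∀ w, ¬ (G.deleteEdges {s(d.fst, d.snd)}).Adj v w} := by
  let ends (e : G.Dart) : Set V := {v | v = e.fst ∧ e = ρ.next e}
  have hcard : ∀ e, (ends e).ncard = ρ.pendant e := by
    intro e
    rw [pendant]
    split_ifs with he
    · simp [ends, ← he]
    · simp [ends, he]
  have hends : Disjoint (ends d) (ends d.symm) :=
    Set.disjoint_left.2 fun _ hv hv' ↦ d.adj.ne (hv.1.symm.trans hv'.1)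
  have hisolated : Disjoint {v | ∀ w, ¬ G.Adj v w} (ends d ∪ ends d.symm) := by
    refine Set.disjoint_left.2 ?_
    rintro v hv (⟨rfl, -⟩ | ⟨rfl, -⟩)
    exacts [hv _ d.adj, hv _ d.adj.symm]
  rw [add_assoc, ← hcard, ← hcard, ← Set.ncard_union_eq hends]
  refine (Set.ncard_union_eq hisolated).symm.trans_le (Set.ncard_le_ncard ?_)
  rintro v (hv | ⟨rfl, hd⟩ | ⟨rfl, hd⟩) w hvw
  · exact hv w (deleteEdges_adj.1 hvw).1
  · exact ρ.not_adj_deleteEdges_of_next_eq hd w hvw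
  · refine ρ.not_adj_deleteEdges_of_next_eq hd w ?_
    rwa [Sym2.eq_swap (a := d.symm.fst)]

section CutRotation

variable [DecidableEq G.Dart] (d₀ : G.Dart)

/-- The rotation with both darts of the edge of `d₀` cut out. -/
def cutRotation : Perm G.Dart := cutOut (cutOut ρ.next d₀) d₀.symm

theorem cutRotation_eq :
    ρ.cutRotation d₀ = swap d₀.symm (ρ.next d₀.symm) * (swap d₀ (ρ.next d₀) * ρ.next) := by
  have h : cutOut ρ.next d₀ d₀.symm = ρ.next d₀.symm :=
    cutOut_apply_of_ne _ d₀.symm_ne (ρ.next_ne_of_fst_ne d₀.adj.ne.symm)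
  rw [cutRotation, cutOut, h, cutOut]

theorem cutRotation_fst (d : G.Dart) : (ρ.cutRotation d₀ d).fst = d.fst := by
  let origin : G.Dart → V := fun d ↦ d.fst
  have hfst : ∀ d, origin (ρ.next d) = origin d := ρ.next_fst
  rw [cutRotation_eq]
  exact apply_swap_mul (apply_swap_mul hfst (hfst d₀).symm) (hfst d₀.symm).symm d

theorem cutRotation_symm : ρ.cutRotation d₀ d₀.symm = d₀.symm := cutOut_self _ _

theorem cutRotation_self : ρ.cutRotation d₀ d₀ = d₀ := by
  have h : cutOut ρ.next d₀ d₀ = d₀ := cutOut_self _ _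
  have hne : d₀ ≠ d₀.symm := d₀.symm_ne.symm
  rw [cutRotation, cutOut_apply_of_ne _ hne (by rwa [h]), h]

theorem cutRotation_ne_iff (d : G.Dart) :
    (ρ.cutRotation d₀ d ≠ d₀ ∧ ρ.cutRotation d₀ d ≠ d₀.symm) ↔ d ≠ d₀ ∧ d ≠ d₀.symm := by
  have h : ∀ {e}, ρ.cutRotation d₀ e = e → (ρ.cutRotation d₀ d = e ↔ d = e) := fun he ↦ by
    rw [← (ρ.cutRotation d₀).apply_eq_iff_eq (x := d), he]
  rw [Ne, Ne, h (ρ.cutRotation_self d₀), h (ρ.cutRotation_symm d₀)]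

/-- The darts that remain after the deletion of an edge. -/
def remainingDarts :
    {d : G.Dart // d ≠ d₀ ∧ d ≠ d₀.symm} ≃ (G.deleteEdges {s(d₀.fst, d₀.snd)}).Dart where
  toFun d := ⟨d.1.toProd, deleteEdges_adj.2
    ⟨d.1.adj, fun he ↦ not_or.2 d.2 ((dart_edge_eq_iff d.1 d₀).1 he)⟩⟩
  invFun d := ⟨⟨d.toProd, (deleteEdges_adj.1 d.adj).1⟩, not_or.1 fun he ↦
    (deleteEdges_adj.1 d.adj).2 ((dart_edge_eq_iff _ d₀).2 he)⟩
  left_inv _ := rfl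
  right_inv _ := rfl

/-- The rotation system left by the deletion of an edge. -/
def deleteEdge [Finite V] : RotationSystem (G.deleteEdges {s(d₀.fst, d₀.snd)}) where
  next := (remainingDarts d₀).permCongr ((ρ.cutRotation d₀).subtypePerm (ρ.cutRotation_ne_iff d₀))
  next_fst d := ρ.cutRotation_fst d₀ ((remainingDarts d₀).symm d).1
  sameCycle_of_fst_eq d e h := by
    let ι := fun d ↦ ((remainingDarts d₀).symm d).1
    have hι : Function.Injective ι :=
      Subtype.val_injective.comp (remainingDarts d₀).symm.injective
    refine sameCycle_of_semiconj hι (f := ρ.cutRotation d₀) (fun _ ↦ by simp [ι]) ?_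
    have hne : ∀ d, ι d ≠ d₀ ∧ ι d ≠ d₀.symm := fun d ↦ ((remainingDarts d₀).symm d).2
    exact sameCycle_cutOut (hne d).2 (hne e).2
      (sameCycle_cutOut (hne d).1 (hne e).1 (ρ.sameCycle_of_fst_eq _ _ h))

theorem deleteEdge_next [Finite V] (d : (G.deleteEdges {s(d₀.fst, d₀.snd)}).Dart) :
    ((remainingDarts d₀).symm ((ρ.deleteEdge d₀).next d)).1 =
      ρ.cutRotation d₀ ((remainingDarts d₀).symm d).1 := by
  simp [deleteEdge, permCongr_apply]

theorem numCycles_cutRotation_le [Finite V] :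
    numCycles (ρ.cutRotation d₀ * dartReverse G) ≤ numCycles (ρ.deleteEdge d₀).facePerm + 1 := by
  set φ := ρ.cutRotation d₀ * dartReverse G
  have hφ : ∀ x, Quotient.mk (SameCycle.setoid φ) (φ x) = Quotient.mk _ x := fun x ↦
    Quotient.sound (sameCycle_apply_left.2 (.refl φ x))
  let toCycle : (G.deleteEdges {s(d₀.fst, d₀.snd)}).Dart → Quotient (SameCycle.setoid φ) :=
    fun d ↦ Quotient.mk _ ((remainingDarts d₀).symm d).1
  refine card_le_numCycles_add_one (h := toCycle) (fun x ↦ ?_) (Quotient.mk _ d₀) ?_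
  · exact (congrArg _ (ρ.deleteEdge_next d₀ x.symm)).trans (hφ ((remainingDarts d₀).symm x).1)
  rintro ⟨x⟩ hx
  -- The two deleted darts form one cycle of `φ`, the only one that is lost.
  refine ⟨remainingDarts d₀ ⟨x, fun h ↦ hx (h ▸ rfl), fun h ↦ hx ?_⟩, rfl⟩
  rw [h, ← hφ d₀]
  exact congrArg _ (ρ.cutRotation_symm d₀).symm

open Classical in
theorem numCycles_cutRotation_ge [Finite V] :
    numCycles ρ.facePerm + (if ρ.facePerm.SameCycle d₀ d₀.symm then 2 else 0) ≤
      numCycles (ρ.cutRotation d₀ * dartReverse G) + ρ.pendant d₀ + ρ.pendant d₀.symm := by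
  set φ := swap d₀ (ρ.next d₀) * ρ.facePerm with hφ
  have hfirst : numCycles ρ.facePerm + (if ρ.facePerm.SameCycle d₀ d₀.symm then 2 else 0) ≤
      numCycles φ + 1 + ρ.pendant d₀ := by
    split_ifs with hs
    · have hs' : ρ.facePerm.SameCycle d₀ (ρ.next d₀) := sameCycle_apply_right.2 hs
      have := numCycles_add_one_le_swap_mul hs'
      rw [← hφ] at this
      rw [pendant_eq]
      omega
    · exact (numCycles_le_swap_mul_add_one _ _ _).trans (Nat.le_add_right _ _)
  have hsecond : numCycles φ + 1 ≤
      numCycles (ρ.cutRotation d₀ * dartReverse G) + ρ.pendant d₀.symm := by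
    have hcycle : φ.SameCycle d₀.symm (ρ.next d₀.symm) := by
      have h₁ : φ d₀.symm = d₀ := by
        rw [hφ, mul_apply, facePerm_symm_apply, swap_apply_right]
      have h₂ : φ d₀ = ρ.next d₀.symm := by
        rw [hφ, mul_apply, facePerm_apply, swap_apply_of_ne_of_ne]
        · exact ρ.next_ne_of_fst_ne d₀.adj.ne.symm
        · exact fun h ↦ d₀.symm_ne (ρ.next.injective h)
      exact ⟨2, by rw [zpow_two, mul_apply, h₁, h₂]⟩
    rw [cutRotation_eq, pendant_eq, mul_assoc, mul_assoc]
    exact numCycles_add_one_le_swap_mul hcycle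
  omega

end CutRotation

end RotationSystem

theorem IsToroidal.deleteEdge [Finite V] (h : IsToroidal G) (d : G.Dart) :
    IsToroidal (G.deleteEdges {s(d.fst, d.snd)}) := by
  classical
  obtain ⟨ρ, hρ⟩ := h
  refine ⟨ρ.deleteEdge d, ?_⟩
  have hle := ρ.numCycles_cutRotation_le d
  have hge := ρ.numCycles_cutRotation_ge d
  have hisolated := ρ.card_isolated_add_pendant_le d
  have hcomponents := card_connectedComponent_deleteEdges_le (G := G) d.fst d.snd
  have hedges : Nat.card (G.deleteEdges {s(d.fst, d.snd)}).edgeSet + 1 = Nat.card G.edgeSet := by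
    rw [Nat.card_coe_set_eq, Nat.card_coe_set_eq, edgeSet_deleteEdges]
    exact Set.ncard_sdiff_singleton_add_one d.adj (Set.toFinite _)
  unfold RotationSystem.eulerChar RotationSystem.numFaces at hρ ⊢
  unfold numCycles at hle hge
  by_cases hs : ρ.facePerm.SameCycle d d.symm
  · rw [if_pos hs] at hge
    omega
  · have hcomponents' :=
      card_connectedComponent_deleteEdges_le_of_reachable (ρ.reachable_of_not_sameCycle d hs)
    rw [if_neg hs] at hge
    omega

theorem IsToroidal.anti [Finite V] {H : SimpleGraph V} (hle : H ≤ G) (h : IsToroidal G) :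
    IsToroidal H := by
  induction hn : G.edgeSet.ncard using Nat.strong_induction_on generalizing G with | _ n ih
  obtain rfl | hlt := hle.eq_or_lt
  · exact h
  obtain ⟨e, heG, heH⟩ := Set.exists_of_ssubset (edgeSet_ssubset_edgeSet.2 hlt)
  induction e using Sym2.ind with | _ u v
  refine ih _ ?_ ?_ (h.deleteEdge ⟨(u, v), heG⟩) rfl
  · rw [← hn, edgeSet_deleteEdges]
    exact Set.ncard_sdiff_singleton_lt_of_mem heG (Set.toFinite _)
  · rw [← deleteEdges_eq_self.2 (Set.disjoint_singleton_right.2 heH)]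
    exact deleteEdges_mono hle

end EdgeDeletion


/-! ### Curvature -/

section Curvature

open Equiv Equiv.Perm SimpleGraph Function

variable {V : Type*} [Finite V] {G : SimpleGraph V}

theorem card_isolated_add_one_le (d : G.Dart) :
    Nat.card {v : V // ∀ w, ¬ G.Adj v w} + 1 ≤ Nat.card G.ConnectedComponent := by
  let component : Option {v : V // ∀ w, ¬ G.Adj v w} → G.ConnectedComponent := fun o ↦
    o.elim (G.connectedComponentMk d.fst) fun v ↦ G.connectedComponentMk v.1
  have hisolated : ∀ {v x : V}, (∀ w, ¬ G.Adj v w) → G.Reachable v x → v = x := by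
    rintro v x hv ⟨p⟩
    cases p with
    | nil => rfl
    | cons h _ => exact absurd h (hv _)
  have hinj : Injective component := by
    rintro (_ | v) (_ | w) h
    · rfl
    · exact absurd d.adj (hisolated w.2 (ConnectedComponent.exact h).symm ▸ w.2 _)
    · exact absurd d.adj (hisolated v.2 (ConnectedComponent.exact h) ▸ v.2 _)
    · exact congrArg some (Subtype.ext (hisolated v.2 (ConnectedComponent.exact h)))
  simpa only [Finite.card_option] using Nat.card_le_card_of_injective component hinj

namespace RotationSystem

variable (ρ : RotationSystem G)

theorem sameCycle_next_iff {d e : G.Dart} : ρ.next.SameCycle d e ↔ d.fst = e.fst :=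
  ⟨eq_of_sameCycle (h := fun d : G.Dart ↦ d.fst) ρ.next_fst, ρ.sameCycle_of_fst_eq d e⟩

theorem minimalPeriod_next (d : G.Dart) : minimalPeriod ρ.next d = valency G d.fst := by
  rw [← ncard_sameCycle, valency]
  refine Set.ncard_congr (fun e _ ↦ e.snd) (fun e he ↦ ?_) (fun e e' he he' h ↦ ?_)
    fun w hw ↦ ⟨⟨(d.fst, w), hw⟩, ρ.sameCycle_next_iff.2 rfl, rfl⟩
  · exact (ρ.sameCycle_next_iff.1 he).symm ▸ e.adj
  · exact Dart.ext _ _ (Prod.ext ((ρ.sameCycle_next_iff.1 he).symm.trans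
      (ρ.sameCycle_next_iff.1 he')) h)

theorem card_le_numCycles_next_add_isolated :
    Nat.card V ≤ numCycles ρ.next + Nat.card {v : V // ∀ w, ¬ G.Adj v w} := by
  let vertex : Quotient (SameCycle.setoid ρ.next) ⊕ {v : V // ∀ w, ¬ G.Adj v w} → V :=
    Sum.elim (Quotient.lift (fun d ↦ d.fst) fun _ _ ↦ ρ.sameCycle_next_iff.1) Subtype.val
  have hsurj : Surjective vertex := by
    intro v
    by_cases hv : ∀ w, ¬ G.Adj v w
    · exact ⟨Sum.inr ⟨v, hv⟩, rfl⟩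
    · obtain ⟨w, hw⟩ := not_forall_not.1 hv
      exact ⟨Sum.inl (Quotient.mk _ ⟨(v, w), hw⟩), rfl⟩
  simpa only [Nat.card_sum, numCycles] using Nat.card_le_card_of_surjective vertex hsurj

/-- The length of the face traced along a dart. -/
noncomputable def faceLength (d : G.Dart) : ℕ := minimalPeriod ρ.facePerm d

theorem card_edgeSet_le (d : G.Dart)
    (h : 2 * (Nat.card G.ConnectedComponent : ℤ) - 2 ≤ ρ.eulerChar) :
    Nat.card G.edgeSet ≤ numCycles ρ.next + numCycles ρ.facePerm := by
  have hvertices := ρ.card_le_numCycles_next_add_isolated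
  have hcomponents := card_isolated_add_one_le d
  unfold eulerChar numFaces at h
  unfold numCycles at *
  omega

/-- The combinatorial Gauss–Bonnet inequality. -/
theorem sum_curvature_nonneg [Fintype G.Dart]
    (h : 2 * (Nat.card G.ConnectedComponent : ℤ) - 2 ≤ ρ.eulerChar) :
    0 ≤ ∑ d : G.Dart, ((1 : ℚ) / valency G d.fst + 1 / ρ.faceLength d - 1 / 2) := by
  classical
  have := Fintype.ofFinite V
  cases isEmpty_or_nonempty G.Dart with
  | inl _ => exact (Fintype.sum_empty _).ge
  | inr hd =>
  have hedges : (Nat.card G.edgeSet : ℚ) ≤ numCycles ρ.next + numCycles ρ.facePerm := by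
    exact_mod_cast ρ.card_edgeSet_le hd.some h
  have hdarts : Fintype.card G.Dart = 2 * Nat.card G.edgeSet := by
    rw [Nat.card_eq_fintype_card, ← edgeFinset_card, ← G.dart_card_eq_twice_card_edges]
    convert rfl
  have hnext : ∑ d : G.Dart, (1 : ℚ) / valency G d.fst = numCycles ρ.next := by
    rw [← sum_one_div_minimalPeriod]
    exact Finset.sum_congr rfl fun d _ ↦ by rw [minimalPeriod_next]
  have hface : ∑ d : G.Dart, (1 : ℚ) / ρ.faceLength d = numCycles ρ.facePerm :=
    sum_one_div_minimalPeriod _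
  rw [Finset.sum_sub_distrib, Finset.sum_add_distrib, hnext, hface, Finset.sum_const,
    Finset.card_univ, hdarts, nsmul_eq_mul]
  push_cast
  linarith

end RotationSystem

end Curvature


/-! ### Cycles sharing an edge -/

section AvoidsConfigurations

variable {V : Type*} {G : SimpleGraph V}

namespace AvoidsConfigurations

theorem eq_of_triangles (hG : AvoidsConfigurations G) {a b c d : V} (hab : G.Adj a b)
    (hac : G.Adj a c) (hcb : G.Adj c b) (had : G.Adj a d) (hdb : G.Adj d b) : c = d := by
  by_contra hcd
  refine hG.1 (fromEdgeSet_isContained [a, c, b, d] (by grind [G.irrefl]) ?_)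
  simp [hab, hac, hcb, had.symm, hdb.symm]

theorem not_adj_diagonal (hG : AvoidsConfigurations G) {a b c d : V} (S : Square G a b c d) :
    ¬ G.Adj a c := by
  intro hac
  have := hG.eq_of_triangles hac S.ab S.bc S.da.symm S.cd.symm
  grind [S.nodup]

theorem not_adj (hG : AvoidsConfigurations G) {a b c d e : V} (P : Pentagon G a b c d e) :
    ¬ G.Adj a c := by
  intro hac
  refine hG.2.1 (fromEdgeSet_isContained [a, b, c, d, e] P.nodup ?_)
  simp [P.ab, P.bc, P.cd, P.de, P.ea, hac]

theorem not_triangle_square (hG : AvoidsConfigurations G) {a b c d x : V} (S : Square G a b c d)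
    (hax : G.Adj a x) (hxb : G.Adj x b) (hxc : x ≠ c) (hxd : x ≠ d) : False :=
  hG.not_adj ⟨by grind [S.nodup, G.irrefl], hax, hxb, S.bc, S.cd, S.da⟩ S.ab

theorem not_square_square (hG : AvoidsConfigurations G) {a b c d x y : V} (S : Square G a b c d)
    (T : Square G a b x y) (hxc : x ≠ c) (hyd : y ≠ d) : False := by
  have hcy : c ≠ y := fun h ↦ hG.not_adj_diagonal S (h ▸ T.da.symm)
  have hdx : d ≠ x := fun h ↦ hG.not_adj_diagonal S.rotate (h ▸ T.bc)
  refine hG.2.2.1 (fromEdgeSet_isContained [a, d, c, b, x, y] ?_ ?_)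
  · grind [S.nodup, T.nodup, G.irrefl]
  · simp [S.da.symm, S.cd.symm, S.bc.symm, T.bc, T.cd, T.da, S.ab]

theorem not_triangle_hexagon (hG : AvoidsConfigurations G) {u v w a b c d : V} (huv : G.Adj u v)
    (hvw : G.Adj v w) (hwu : G.Adj w u) (hua : G.Adj u a) (hab : G.Adj a b) (hbc : G.Adj b c)
    (hcd : G.Adj c d) (hdv : G.Adj d v) (hwa : w ≠ a) (hwd : w ≠ d) (hva : v ≠ a) (hub : u ≠ b)
    (hac : a ≠ c) (hbd : b ≠ d) (hcv : c ≠ v) (hdu : d ≠ u) : False := by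
  have hbv : b ≠ v := fun h ↦ hwa (hG.eq_of_triangles huv hwu.symm hvw.symm hua (h ▸ hab))
  have hcu : c ≠ u := fun h ↦ hwd (hG.eq_of_triangles huv hwu.symm hvw.symm (h ▸ hcd) hdv)
  have had : a ≠ d := fun h ↦ hwa (hG.eq_of_triangles huv hwu.symm hvw.symm hua (h ▸ hdv))
  have hwb : w ≠ b := fun h ↦ hva (hG.eq_of_triangles hwu.symm huv hvw hua (h ▸ hab))
  have hwc : w ≠ c := fun h ↦ hdu (hG.eq_of_triangles hvw hdv.symm (h ▸ hcd.symm) huv.symm hwu.symm)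
  refine hG.2.2.2.1 (fromEdgeSet_isContained [v, u, a, b, c, d, w] ?_ ?_)
  · grind [G.irrefl]
  · simp [huv.symm, hua, hab, hbc, hcd, hdv, hvw, hwu]

end AvoidsConfigurations

namespace Pentagon

variable {a b c d e x y : V}

theorem notMem_of_triangle (P : Pentagon G a b c d e) (hG : AvoidsConfigurations G)
    (hax : G.Adj a x) (hxb : G.Adj x b) : x ∉ [a, b, c, d, e] := by
  have := hG.not_adj P
  have := hG.not_adj P.rotate.rotate.rotate
  have := hG.not_adj P.rotate.rotate.rotate.rotate
  grind [G.irrefl, G.adj_comm]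

theorem not_adj_apex (P : Pentagon G a b c d e) (hG : AvoidsConfigurations G)
    (hax : G.Adj a x) (hxb : G.Adj x b) : ¬ G.Adj x c ∧ ¬ G.Adj x d ∧ ¬ G.Adj x e := by
  have hx := P.notMem_of_triangle hG hax hxb
  have hn := P.nodup
  refine ⟨fun h ↦ ?_, fun h ↦ ?_, fun h ↦ ?_⟩
  · have := hG.eq_of_triangles hxb hax.symm P.ab h P.bc.symm
    grind
  · exact hG.not_adj ⟨by grind, P.ab.symm, hax, h, P.cd.symm, P.bc.symm⟩ hxb.symm
  · have := hG.eq_of_triangles hax.symm hxb P.ab.symm h P.ea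
    grind

theorem not_triangle_triangle_adj (P : Pentagon G a b c d e) (hG : AvoidsConfigurations G)
    (hax : G.Adj a x) (hxb : G.Adj x b) (hby : G.Adj b y) (hyc : G.Adj y c) : False := by
  have hx := P.notMem_of_triangle hG hax hxb
  have hy := P.rotate.notMem_of_triangle hG hby hyc
  have hxc := (P.not_adj_apex hG hax hxb).1
  refine hG.2.2.2.1 (fromEdgeSet_isContained [b, c, d, e, a, x, y] ?_ ?_)
  · grind [P.nodup]
  · simp [P.bc, P.cd, P.de, P.ea, hax, hxb, hby, hyc]

theorem not_triangle_triangle_disj (P : Pentagon G a b c d e) (hG : AvoidsConfigurations G)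
    (hax : G.Adj a x) (hxb : G.Adj x b) (hcy : G.Adj c y) (hyd : G.Adj y d) : False := by
  have hx := P.notMem_of_triangle hG hax hxb
  have hy := P.rotate.rotate.notMem_of_triangle hG hcy hyd
  have hxd := (P.not_adj_apex hG hax hxb).2.1
  refine hG.2.2.2.1 (fromEdgeSet_isContained [c, d, e, a, x, b, y] ?_ ?_)
  · grind [P.nodup]
  · simp [P.bc, P.cd, P.de, P.ea, hax, hxb, hcy, hyd]

theorem notMem_of_square (P : Pentagon G a b c d e) (hG : AvoidsConfigurations G)
    (S : Square G a b x y) (hxc : x ≠ c) (hye : y ≠ e) :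
    x ∉ [a, b, c, d, e] ∧ y ∉ [a, b, c, d, e] := by
  have := hG.not_adj P
  have := hG.not_adj P.rotate
  have := hG.not_adj P.rotate.rotate.rotate
  have := hG.not_adj P.rotate.rotate.rotate.rotate
  grind [S.nodup, S.bc, S.da, G.adj_comm]

theorem not_triangle_square_bc (P : Pentagon G a b c d e) (hG : AvoidsConfigurations G)
    (hax : G.Adj a x) (hxb : G.Adj x b) (S : Square G b c y z) (hyd : y ≠ d) (hza : z ≠ a) :
    False := by
  have hx := P.notMem_of_triangle hG hax hxb
  have hyz := P.rotate.notMem_of_square hG S hyd hza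
  have hxy : x ≠ y := fun h ↦ (P.not_adj_apex hG hax hxb).1 (h ▸ S.bc.symm)
  have hxz : x ≠ z := by
    rintro rfl
    exact hG.not_adj ⟨by grind [P.nodup, S.nodup], P.ab.symm, hax, S.cd.symm, S.bc.symm, P.bc.symm⟩
      hxb.symm
  refine hG.2.2.2.2.1 (fromEdgeSet_isContained [c, b, a, e, d, x, z, y] ?_ ?_)
  · grind [P.nodup, S.nodup]
  · simp [P.bc.symm, P.cd.symm, P.de.symm, P.ea.symm, P.ab.symm, hax.symm, hxb.symm, S.bc.symm,
      S.cd.symm, S.da.symm]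

theorem not_triangle_square_cd (P : Pentagon G a b c d e) (hG : AvoidsConfigurations G)
    (hax : G.Adj a x) (hxb : G.Adj x b) (S : Square G c d y z) (hye : y ≠ e) (hzb : z ≠ b) :
    False := by
  have hx := P.notMem_of_triangle hG hax hxb
  have hyz := P.rotate.rotate.notMem_of_square hG S hye hzb
  have hxz : x ≠ z := fun h ↦ (P.not_adj_apex hG hax hxb).1 (h ▸ S.da)
  have hxy : x ≠ y := fun h ↦ (P.not_adj_apex hG hax hxb).2.1 (h ▸ S.bc.symm)
  refine hG.2.2.2.2.2 (fromEdgeSet_isContained [d, c, b, a, e, x, z, y] ?_ ?_)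
  · grind [P.nodup, S.nodup]
  · simp [P.bc.symm, P.cd.symm, P.de.symm, P.ea.symm, P.ab.symm, hax.symm, hxb.symm, S.bc.symm,
      S.cd.symm, S.da.symm]

theorem not_triangle_square_de (P : Pentagon G a b c d e) (hG : AvoidsConfigurations G)
    (hax : G.Adj a x) (hxb : G.Adj x b) (S : Square G d e y z) (hya : y ≠ a) (hzc : z ≠ c) :
    False :=
  P.reverse.rotate.rotate.rotate.not_triangle_square_cd hG hxb.symm hax.symm S.swap hzc hya

theorem not_triangle_square_ea (P : Pentagon G a b c d e) (hG : AvoidsConfigurations G)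
    (hax : G.Adj a x) (hxb : G.Adj x b) (S : Square G e a y z) (hyb : y ≠ b) (hzd : z ≠ d) :
    False :=
  P.reverse.rotate.rotate.rotate.not_triangle_square_bc hG hxb.symm hax.symm S.swap hzd hyb

end Pentagon

/-- A graph without the six configurations to which no reduction applies. -/
structure IsObstruction (G : SimpleGraph V) : Prop where
  avoids : AvoidsConfigurations G
  not_hasReducible : ¬ HasReducible 2 G

namespace IsObstruction

variable [Finite V]

theorem three_le (hG : IsObstruction G) {v w : V} (hvw : G.Adj v w) : 3 ≤ valency G v := by
  by_contra! hv
  exact hG.not_hasReducible (hasReducible_of_valency_le hvw (by omega))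

theorem eq_of_valency_le_three (hG : IsObstruction G) {a b c d e x : V} (P : Pentagon G a b c d e)
    (hax : G.Adj a x) (hxb : G.Adj x b) (h4 : ∀ v ∈ [a, b, c, d, e, x], valency G v ≤ 4) {u v : V}
    (hu : u ∈ [a, b, c, d, e]) (hv : v ∈ [a, b, c, d, e]) (hu3 : valency G u ≤ 3)
    (hv3 : valency G v ≤ 3) : u = v := by
  have hn := P.nodup
  have hx := P.notMem_of_triangle hG.avoids hax hxb
  have hadj {u v : V} (huv : G.Adj u v) : ¬ (valency G u ≤ 3 ∧ valency G v ≤ 3) :=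
    fun h ↦ hG.not_hasReducible (hasReducible_of_adj huv h.1 h.2)
  simp only [List.forall_mem_cons] at h4
  obtain ⟨va, vb, vc, vd, ve, vx, -⟩ := h4
  have hab := hadj P.ab
  have hbc := hadj P.bc
  have hcd := hadj P.cd
  have hde := hadj P.de
  have hea := hadj P.ea
  have hac : ¬ (valency G a ≤ 3 ∧ valency G c ≤ 3) := fun h ↦ hG.not_hasReducible <|
    hasReducible_of_triangle_edge (by grind) P.ab P.bc hax hxb h.1 vb h.2 vx
  have hbe : ¬ (valency G b ≤ 3 ∧ valency G e ≤ 3) := fun h ↦ hG.not_hasReducible <|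
    hasReducible_of_triangle_edge (by grind) P.ab.symm P.ea.symm hxb.symm hax.symm h.1 va h.2 vx
  have had : ¬ (valency G a ≤ 3 ∧ valency G d ≤ 3) := fun h ↦ hG.not_hasReducible <|
    P.hasReducible_of_triangle_ad hx hax hxb h.1 vb vc h.2 ve vx
  have hbd : ¬ (valency G b ≤ 3 ∧ valency G d ≤ 3) := fun h ↦ hG.not_hasReducible <|
    P.reverse.rotate.rotate.rotate.hasReducible_of_triangle_ad (by grind) hxb.symm hax.symm
      h.1 va ve h.2 vc vx
  have hce : ¬ (valency G c ≤ 3 ∧ valency G e ≤ 3) := fun h ↦ hG.not_hasReducible <|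
    P.hasReducible_of_triangle_ce hx hax hxb va vb h.1 vd h.2 vx
  simp only [List.mem_cons, List.not_mem_nil, or_false] at hu hv
  rcases hu with rfl | rfl | rfl | rfl | rfl <;> grind

theorem not_hub (hG : IsObstruction G) {h a r c d s y z p : V} (S : Square G h p a r)
    (P : Pentagon G h r c d s) (Q : Pentagon G h s y z p) (hac : a ≠ c) (haz : a ≠ z) (hdy : d ≠ y)
    (h4 : ∀ v, valency G v ≤ 4) (hh : valency G h ≤ 3)
    (hcd : valency G c ≤ 3 ∨ valency G d ≤ 3) (hyz : valency G y ≤ 3 ∨ valency G z ≤ 3) :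
    False := by
  have hnP := P.nodup
  have hnQ := Q.nodup
  have haP := P.notMem_of_square hG.avoids S.rotate.rotate.rotate.swap hac (by grind)
  have haQ := Q.rotate.rotate.rotate.rotate.notMem_of_square hG.avoids S.swap (by grind) haz
  have hcy : c ≠ y := fun h ↦ hG.avoids.not_adj P.rotate.rotate (h ▸ Q.bc.symm)
  have hdz : d ≠ z := fun h ↦ hG.avoids.not_adj Q.rotate (h ▸ P.de.symm)
  by_cases hcz : c = z
  · subst hcz
    have hc : 4 ≤ valency G c := length_le_valency (l := [r, d, y, p]) (by grind)
      (by simp [P.bc.symm, P.cd, Q.cd.symm, Q.de])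
    exact hG.not_hasReducible <| Square.hasReducible (a := d) (b := s) (c := y) (d := c)
      ⟨by grind, P.de, Q.bc, Q.cd, P.cd⟩ (by omega) (h4 _) (by omega) (h4 _)
  · refine hG.not_hasReducible <| Hub.hasReducible (a := a) (h := h)
      ⟨by grind, P, Q, S.cd, S.bc, hh, fun v _ ↦ h4 v⟩ hcd hyz

end IsObstruction

end AvoidsConfigurations


/-! ### Faces of an obstruction -/

section Faces

open Function

variable {V : Type*} {G : SimpleGraph V}

namespace RotationSystem

variable (ρ : RotationSystem G)

/-- The vertices of the face of `d`, in the order in which face tracing visits them from `d` on. -/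
def faceVertex (d : G.Dart) (i : ℕ) : V := (ρ.facePerm^[i] d).fst

theorem faceVertex_iterate (d : G.Dart) (i j : ℕ) :
    ρ.faceVertex (ρ.facePerm^[i] d) j = ρ.faceVertex d (j + i) := by
  rw [faceVertex, faceVertex, iterate_add_apply]

theorem snd_iterate_facePerm (d : G.Dart) (i : ℕ) :
    (ρ.facePerm^[i] d).snd = ρ.faceVertex d (i + 1) := by
  rw [faceVertex, iterate_succ_apply', facePerm_fst]

theorem adj_faceVertex (d : G.Dart) (i : ℕ) :
    G.Adj (ρ.faceVertex d i) (ρ.faceVertex d (i + 1)) := by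
  rw [← snd_iterate_facePerm]
  exact (ρ.facePerm^[i] d).adj

theorem faceVertex_symm_zero (d : G.Dart) : ρ.faceVertex d.symm 0 = ρ.faceVertex d 1 :=
  (ρ.facePerm_fst d).symm

theorem faceVertex_symm_one (d : G.Dart) : ρ.faceVertex d.symm 1 = ρ.faceVertex d 0 :=
  ρ.facePerm_fst d.symm

theorem adj_faceVertex_symm_two (d : G.Dart) :
    G.Adj (ρ.faceVertex d 0) (ρ.faceVertex d.symm 2) := by
  simpa only [faceVertex_symm_one] using ρ.adj_faceVertex d.symm 1

theorem facePerm_symm_snd (d : G.Dart) : (ρ.facePerm.symm d).snd = d.fst := by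
  rw [← facePerm_fst, Equiv.apply_symm_apply]

theorem symm_facePerm_symm (d : G.Dart) : (ρ.facePerm.symm d).symm = ρ.next.symm d := by
  rw [Equiv.eq_symm_apply, ← facePerm_apply, Equiv.apply_symm_apply]

theorem faceLength_iterate_facePerm [Finite V] (d : G.Dart) (i : ℕ) :
    ρ.faceLength (ρ.facePerm^[i] d) = ρ.faceLength d :=
  minimalPeriod_apply_iterate (mem_periodicPts ρ.facePerm d) i

theorem faceLength_facePerm [Finite V] (d : G.Dart) :
    ρ.faceLength (ρ.facePerm d) = ρ.faceLength d :=
  ρ.faceLength_iterate_facePerm d 1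

theorem faceLength_facePerm_symm [Finite V] (d : G.Dart) :
    ρ.faceLength (ρ.facePerm.symm d) = ρ.faceLength d := by
  rw [← faceLength_facePerm, Equiv.apply_symm_apply]

theorem faceLength_next [Finite V] (d : G.Dart) :
    ρ.faceLength (ρ.next d) = ρ.faceLength d.symm := by
  rw [← facePerm_symm_apply, faceLength_facePerm]

theorem next_next_next [Finite V] {d : G.Dart} (h : valency G d.fst = 3) :
    ρ.next (ρ.next (ρ.next d)) = d := by
  have := iterate_minimalPeriod (f := ρ.next) (x := d)
  rwa [minimalPeriod_next, h] at this

variable {ρ} {d : G.Dart} {n : ℕ}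

theorem iterate_facePerm_of_faceLength (h : ρ.faceLength d = n) : ρ.facePerm^[n] d = d :=
  h ▸ iterate_minimalPeriod

theorem faceVertex_add_faceLength (h : ρ.faceLength d = n) (i : ℕ) :
    ρ.faceVertex d (i + n) = ρ.faceVertex d i := by
  rw [faceVertex, iterate_add_apply, iterate_facePerm_of_faceLength h, faceVertex]

theorem faceVertex_symm_two_adj (h : ρ.faceLength d.symm = 3) :
    G.Adj (ρ.faceVertex d.symm 2) (ρ.faceVertex d 1) := by
  have hadj := ρ.adj_faceVertex d.symm 2
  rwa [faceVertex_add_faceLength h 0, faceVertex_symm_zero] at hadj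

theorem facePerm_symm_fst_of_faceLength (h : ρ.faceLength d = n + 1) :
    (ρ.facePerm.symm d).fst = ρ.faceVertex d n := by
  have hlast : ρ.facePerm.symm d = ρ.facePerm^[n] d := by
    rw [Equiv.symm_apply_eq, ← iterate_succ_apply' ρ.facePerm, iterate_facePerm_of_faceLength h]
  rw [hlast, faceVertex]

theorem iterate_next_ne [Finite V] (hn : 0 < n) (h : n < valency G d.fst) : ρ.next^[n] d ≠ d :=
  not_isPeriodicPt_of_pos_of_lt_minimalPeriod hn.ne' (by rwa [minimalPeriod_next])

end RotationSystem

namespace IsObstruction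

variable [Finite V] {ρ : RotationSystem G}

theorem not_valency_three (hG : IsObstruction G) {u v : V} (huv : G.Adj u v)
    (hu : valency G u = 3) (hv : valency G v = 3) : False :=
  hG.not_hasReducible (hasReducible_of_adj huv hu.le hv.le)

theorem faceVertex_ne (hG : IsObstruction G) (d : G.Dart) (i : ℕ) :
    ρ.faceVertex d i ≠ ρ.faceVertex d (i + 2) := by
  intro h
  have h3 := hG.three_le (ρ.facePerm^[i] d).symm.adj
  refine ρ.iterate_next_ne (d := (ρ.facePerm^[i] d).symm) one_pos (by omega) ?_
  rw [iterate_one, ← RotationSystem.facePerm_apply]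
  refine SimpleGraph.Dart.ext _ _ (Prod.ext (ρ.facePerm_fst _) ?_)
  exact (iterate_succ_apply' ρ.facePerm i d ▸ ρ.snd_iterate_facePerm d (i + 1)).trans h.symm

theorem faceVertex_symm_two_ne (hG : IsObstruction G) (d : G.Dart) :
    ρ.faceVertex d.symm 2 ≠ (ρ.facePerm.symm d).fst := by
  intro h
  have h3 := hG.three_le d.adj
  refine ρ.iterate_next_ne (d := d) two_pos (by omega) ?_
  change ρ.next (ρ.next d) = d
  rw [← Equiv.eq_symm_apply, ← ρ.symm_facePerm_symm]
  exact SimpleGraph.Dart.ext _ _ (Prod.ext ((ρ.next_fst d).trans (ρ.facePerm_symm_snd d).symm)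
    ((ρ.snd_iterate_facePerm d.symm 1).trans h))

theorem three_le_faceLength (hG : IsObstruction G) (d : G.Dart) : 3 ≤ ρ.faceLength d := by
  have hpos : 0 < ρ.faceLength d := minimalPeriod_pos ρ.facePerm d
  by_contra! hlt
  obtain h | h : ρ.faceLength d = 1 ∨ ρ.faceLength d = 2 := by omega
  · exact (ρ.adj_faceVertex d 0).ne (ρ.faceVertex_add_faceLength h 0).symm
  · exact hG.faceVertex_ne d 0 (ρ.faceVertex_add_faceLength h 0).symm

theorem square (hG : IsObstruction G) {d : G.Dart} (h : ρ.faceLength d = 4) :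
    Square G (ρ.faceVertex d 0) (ρ.faceVertex d 1) (ρ.faceVertex d 2) (ρ.faceVertex d 3) := by
  have hda := ρ.adj_faceVertex d 3
  rw [ρ.faceVertex_add_faceLength h 0] at hda
  have hne := hG.faceVertex_ne (ρ := ρ) d
  refine ⟨?_, ρ.adj_faceVertex d 0, ρ.adj_faceVertex d 1, ρ.adj_faceVertex d 2, hda⟩
  grind [hne 0, hne 1, ρ.adj_faceVertex d 0, ρ.adj_faceVertex d 1, ρ.adj_faceVertex d 2, G.irrefl]

theorem pentagon (hG : IsObstruction G) {d : G.Dart} (h : ρ.faceLength d = 5) :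
    Pentagon G (ρ.faceVertex d 0) (ρ.faceVertex d 1) (ρ.faceVertex d 2) (ρ.faceVertex d 3)
      (ρ.faceVertex d 4) := by
  have hea := ρ.adj_faceVertex d 4
  rw [ρ.faceVertex_add_faceLength h 0] at hea
  have hne := hG.faceVertex_ne (ρ := ρ) d
  have h5 := ρ.faceVertex_add_faceLength h 0
  have h6 := ρ.faceVertex_add_faceLength h 1
  refine ⟨?_, ρ.adj_faceVertex d 0, ρ.adj_faceVertex d 1, ρ.adj_faceVertex d 2,
    ρ.adj_faceVertex d 3, hea⟩
  grind [hne 0, hne 1, hne 2, hne 3, hne 4, ρ.adj_faceVertex d 0, ρ.adj_faceVertex d 1,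
    ρ.adj_faceVertex d 2, ρ.adj_faceVertex d 3, G.irrefl]

theorem exists_triangle_across (hG : IsObstruction G) {d : G.Dart} {n : ℕ}
    (hd : ρ.faceLength d = n + 1) (h : ρ.faceLength d.symm = 3) :
    ∃ x, G.Adj (ρ.faceVertex d 0) x ∧ G.Adj x (ρ.faceVertex d 1) ∧ x ≠ ρ.faceVertex d 2 ∧
      x ≠ ρ.faceVertex d n := by
  refine ⟨ρ.faceVertex d.symm 2, ρ.adj_faceVertex_symm_two d, ρ.faceVertex_symm_two_adj h, ?_, ?_⟩
  · rw [← ρ.facePerm_symm_fst_of_faceLength h]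
    exact (hG.faceVertex_symm_two_ne d.symm).symm
  · rw [← ρ.facePerm_symm_fst_of_faceLength hd]
    exact hG.faceVertex_symm_two_ne d

theorem exists_square_across (hG : IsObstruction G) {d : G.Dart} {n : ℕ}
    (hd : ρ.faceLength d = n + 1) (h : ρ.faceLength d.symm = 4) :
    ∃ y z, Square G (ρ.faceVertex d 0) (ρ.faceVertex d 1) y z ∧ y ≠ ρ.faceVertex d 2 ∧
      z ≠ ρ.faceVertex d n := by
  refine ⟨ρ.faceVertex d.symm 3, ρ.faceVertex d.symm 2, ?_, ?_, ?_⟩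
  · have := (hG.square h).swap
    rwa [ρ.faceVertex_symm_zero, ρ.faceVertex_symm_one] at this
  · rw [← ρ.facePerm_symm_fst_of_faceLength h]
    exact (hG.faceVertex_symm_two_ne d.symm).symm
  · rw [← ρ.facePerm_symm_fst_of_faceLength hd]
    exact hG.faceVertex_symm_two_ne d

theorem not_triangle_face_square_face (hG : IsObstruction G) {d : G.Dart}
    (h : ρ.faceLength d = 4) (h' : ρ.faceLength d.symm = 3) : False := by
  obtain ⟨x, hax, hxb, hxc, hxd⟩ := hG.exists_triangle_across h h'
  exact hG.avoids.not_triangle_square (hG.square h) hax hxb hxc hxd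

theorem five_le_faceLength_symm (hG : IsObstruction G) {d : G.Dart} (h : ρ.faceLength d ≤ 4) :
    5 ≤ ρ.faceLength d.symm := by
  have h3 := hG.three_le_faceLength (ρ := ρ) d
  have h3' := hG.three_le_faceLength (ρ := ρ) d.symm
  by_contra! h'
  obtain h | h : ρ.faceLength d = 3 ∨ ρ.faceLength d = 4 := by omega
  all_goals obtain h' | h' : ρ.faceLength d.symm = 3 ∨ ρ.faceLength d.symm = 4 := by omega
  · obtain ⟨x, hax, hxb, hxc, -⟩ := hG.exists_triangle_across h h'
    have hca := ρ.adj_faceVertex d 2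
    rw [ρ.faceVertex_add_faceLength h 0] at hca
    exact hxc (hG.avoids.eq_of_triangles (ρ.adj_faceVertex d 0) hax hxb hca.symm
      (ρ.adj_faceVertex d 1).symm)
  · exact hG.not_triangle_face_square_face h' (by rwa [d.symm_symm])
  · exact hG.not_triangle_face_square_face h h'
  · obtain ⟨y, z, S, hyc, hzd⟩ := hG.exists_square_across h h'
    exact hG.avoids.not_square_square (hG.square h) S hyc hzd

theorem faceLength_symm_ne_three (hG : IsObstruction G) {d : G.Dart} (h : ρ.faceLength d = 6) :
    ρ.faceLength d.symm ≠ 3 := by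
  intro h'
  obtain ⟨x, hax, hxb, hxc, hxd⟩ := hG.exists_triangle_across h h'
  have hne := hG.faceVertex_ne (ρ := ρ) d
  have h6 := ρ.faceVertex_add_faceLength h
  have hadj := ρ.adj_faceVertex d
  refine hG.avoids.not_triangle_hexagon (hadj 0).symm hax hxb (hadj 1) (hadj 2) (hadj 3) (hadj 4)
    (h6 0 ▸ hadj 5) hxc hxd (hne 0) (hne 1) (hne 2) (hne 3) (h6 0 ▸ hne 4) (h6 1 ▸ hne 5)

theorem five_le_faceLength_symm_iterate (hG : IsObstruction G) {d : G.Dart} {i : ℕ}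
    (h : ρ.faceLength d = 5) (h' : ρ.faceLength d.symm = 3) (hi : 0 < i) (hi5 : i < 5) :
    5 ≤ ρ.faceLength (ρ.facePerm^[i] d).symm := by
  have P := hG.pentagon h
  obtain ⟨x, hax, hxb, -, -⟩ := hG.exists_triangle_across h h'
  have hlen := (ρ.faceLength_iterate_facePerm d i).trans h
  have hmod := ρ.faceVertex_add_faceLength h
  have h3 := hG.three_le_faceLength (ρ := ρ) (ρ.facePerm^[i] d).symm
  by_contra! hlt
  obtain h'' | h'' : ρ.faceLength (ρ.facePerm^[i] d).symm = 3 ∨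
    ρ.faceLength (ρ.facePerm^[i] d).symm = 4 := by omega
  · obtain ⟨y, hy, hy', -, -⟩ := hG.exists_triangle_across hlen h''
    rw [ρ.faceVertex_iterate] at hy hy'
    interval_cases i
    · exact P.not_triangle_triangle_adj hG.avoids hax hxb hy hy'
    · exact P.not_triangle_triangle_disj hG.avoids hax hxb hy hy'
    · exact P.rotate.rotate.rotate.not_triangle_triangle_disj hG.avoids hy hy' hax hxb
    · exact P.rotate.rotate.rotate.rotate.not_triangle_triangle_adj hG.avoids hy (hmod 0 ▸ hy')
        hax hxb
  · obtain ⟨y, z, S, hy, hz⟩ := hG.exists_square_across hlen h''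
    simp only [ρ.faceVertex_iterate] at S hy hz
    interval_cases i
    · exact P.not_triangle_square_bc hG.avoids hax hxb S hy (hmod 0 ▸ hz)
    · exact P.not_triangle_square_cd hG.avoids hax hxb S hy (hmod 1 ▸ hz)
    · exact P.not_triangle_square_de hG.avoids hax hxb S (hmod 0 ▸ hy) (hmod 2 ▸ hz)
    · exact P.not_triangle_square_ea hG.avoids hax hxb (hmod 0 ▸ S) (hmod 1 ▸ hy) (hmod 3 ▸ hz)

end IsObstruction

end Faces


/-! ### Discharging -/

section Discharging

open Equiv Equiv.Perm Function Finset

theorem sum_iterate_mean {α : Type*} [Fintype α] (σ : Perm α) (f : α → ℚ) {n : ℕ} (hn : n ≠ 0) :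
    ∑ a, (∑ i ∈ range n, f (σ^[i] a)) / n = ∑ a, f a := by
  have hshift : ∀ i, ∑ a, f (σ^[i] a) = ∑ a, f a := by
    intro i
    rw [iterate_eq_pow]
    exact Equiv.sum_comp (σ ^ i) f
  rw [← sum_div, sum_comm, sum_congr rfl fun i _ ↦ hshift i, sum_const, card_range, nsmul_eq_mul,
    mul_div_cancel_left₀ _ (Nat.cast_ne_zero.2 hn)]

variable {V : Type*} {G : SimpleGraph V}

/-- The indicator of the vertices of degree at least five. -/
noncomputable def big (G : SimpleGraph V) (v : V) : ℚ := if 5 ≤ valency G v then 1 else 0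

theorem big_nonneg (v : V) : 0 ≤ big G v := by
  unfold big
  split_ifs <;> simp

theorem big_eq_one {v : V} (h : 5 ≤ valency G v) : big G v = 1 := if_pos h

theorem big_eq_zero {v : V} (h : valency G v ≤ 4) : big G v = 0 := if_neg (by omega)

namespace RotationSystem

variable (ρ : RotationSystem G)

/-- The indicator of the darts of triangular faces. -/
noncomputable def tri (d : G.Dart) : ℚ := if ρ.faceLength d = 3 then 1 else 0

/-- What the face of a dart pays to the initial vertex of the dart, namely to a vertex of degree
three if the face has length at least five: three units if another face at that vertex has length at
most four, otherwise two. -/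
noncomputable def pay (d : G.Dart) : ℚ :=
  if valency G d.fst = 3 ∧ 5 ≤ ρ.faceLength d then
    if ρ.faceLength (ρ.next d) ≤ 4 ∨ ρ.faceLength (ρ.next.symm d) ≤ 4 then 3 else 2
  else 0

/-- The final charge of the initial vertex of a dart, distributed evenly over the darts leaving it.
It starts as `6 - 24 / valency`; a vertex of degree at least five gives away one unit per dart. -/
noncomputable def vertexCharge (d : G.Dart) : ℚ :=
  6 - 24 / valency G d.fst + ρ.pay d - big G d.fst

/-- The share of a dart in the final charge of its face. It starts as `6 - 24 / faceLength`; a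
triangular face receives two units through each edge, and passes the unit coming from a vertex of
degree at least five on through the opposite edge. -/
noncomputable def faceCharge (d : G.Dart) : ℚ :=
  6 - 24 / ρ.faceLength d - ρ.pay d - 2 * ρ.tri d.symm + 2 * ρ.tri d +
    big G d.fst * (1 - ρ.tri d) + big G (ρ.faceVertex d.symm 2) * ρ.tri d.symm

variable {ρ} {d : G.Dart}

theorem tri_eq_one (h : ρ.faceLength d = 3) : ρ.tri d = 1 := if_pos h

theorem tri_eq_zero (h : ρ.faceLength d ≠ 3) : ρ.tri d = 0 := if_neg h

variable (ρ d)

theorem tri_nonneg : 0 ≤ ρ.tri d := by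
  unfold tri
  split_ifs <;> simp

theorem tri_le_one : ρ.tri d ≤ 1 := by
  unfold tri
  split_ifs <;> simp

theorem pay_le_three : ρ.pay d ≤ 3 := by
  unfold pay
  split_ifs <;> norm_num

variable {ρ d}

theorem pay_eq_zero (h : valency G d.fst ≠ 3) : ρ.pay d = 0 := if_neg fun h' ↦ h h'.1

theorem valency_eq_three_of_pay_ne_zero (h : ρ.pay d ≠ 0) : valency G d.fst = 3 :=
  of_not_not fun h' ↦ h (pay_eq_zero h')

theorem pay_eq_zero_of_faceLength_le (h : ρ.faceLength d ≤ 4) : ρ.pay d = 0 :=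
  if_neg fun h' ↦ by omega

theorem pay_le_two [Finite V] (h : 5 ≤ ρ.faceLength d.symm)
    (h' : 5 ≤ ρ.faceLength (ρ.facePerm.symm d).symm) : ρ.pay d ≤ 2 := by
  rw [symm_facePerm_symm] at h'
  rw [← faceLength_next] at h
  unfold pay
  split_ifs with _ hsmall
  · omega
  all_goals norm_num

theorem big_div_five_le_vertexCharge (h : 4 ≤ valency G d.fst) :
    big G d.fst / 5 ≤ ρ.vertexCharge d := by
  have hpay : ρ.pay d = 0 := pay_eq_zero (by omega)
  rw [vertexCharge, hpay]
  obtain h4 | h5 : valency G d.fst = 4 ∨ 5 ≤ valency G d.fst := by omega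
  · norm_num [big_eq_zero h4.le, h4]
  · have : (24 : ℚ) / valency G d.fst ≤ 24 / 5 := by
      gcongr
      exact_mod_cast h5
    rw [big_eq_one h5]
    linarith

theorem sum_charge [Finite V] [Fintype G.Dart] :
    ∑ d, ρ.vertexCharge d + ∑ d, ρ.faceCharge d =
      -24 * ∑ d : G.Dart, ((1 : ℚ) / valency G d.fst + 1 / ρ.faceLength d - 1 / 2) := by
  have htri : ∑ d : G.Dart, ρ.tri d.symm = ∑ d, ρ.tri d :=
    Equiv.sum_comp (dartReverse G) ρ.tri
  have hbig : ∑ d : G.Dart, big G (ρ.faceVertex d.symm 2) * ρ.tri d.symm =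
      ∑ d : G.Dart, big G d.fst * ρ.tri d := by
    refine (Equiv.sum_comp (dartReverse G) fun d ↦ big G (ρ.faceVertex d 2) * ρ.tri d).trans ?_
    rw [← Equiv.sum_comp (ρ.facePerm ^ 2) fun d ↦ big G d.fst * ρ.tri d, ← iterate_eq_pow]
    exact sum_congr rfl fun d _ ↦ by rw [tri, tri, faceLength_iterate_facePerm, faceVertex]
  calc ∑ d, ρ.vertexCharge d + ∑ d, ρ.faceCharge d
    _ = -24 * ∑ d : G.Dart, ((1 : ℚ) / valency G d.fst + 1 / ρ.faceLength d - 1 / 2) +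
          2 * (∑ d, ρ.tri d - ∑ d : G.Dart, ρ.tri d.symm) +
          (∑ d : G.Dart, big G (ρ.faceVertex d.symm 2) * ρ.tri d.symm -
            ∑ d : G.Dart, big G d.fst * ρ.tri d) := by
      simp only [← sum_add_distrib, ← sum_sub_distrib, mul_sum]
      exact sum_congr rfl fun d _ ↦ by rw [vertexCharge, faceCharge]; ring
    _ = _ := by rw [htri, hbig]; ring

end RotationSystem

namespace IsObstruction

variable [Finite V] {ρ : RotationSystem G} {d : G.Dart}

theorem five_le_faceLength_next (hG : IsObstruction G) (h : ρ.faceLength d ≤ 4) :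
    5 ≤ ρ.faceLength (ρ.next d) := by
  rw [ρ.faceLength_next]
  exact hG.five_le_faceLength_symm h

theorem sum_pay_next (hG : IsObstruction G) (h : valency G d.fst = 3) :
    ρ.pay d + ρ.pay (ρ.next d) + ρ.pay (ρ.next (ρ.next d)) = 6 := by
  have hcycle := ρ.next_next_next h
  have hprev : ρ.next.symm d = ρ.next (ρ.next d) := by rw [Equiv.symm_apply_eq, hcycle]
  have h0 := hG.five_le_faceLength_next (ρ := ρ) (d := d)
  have h1 := hG.five_le_faceLength_next (ρ := ρ) (d := ρ.next d)
  have h2 := hG.five_le_faceLength_next (ρ := ρ) (d := ρ.next (ρ.next d))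
  rw [hcycle] at h2
  simp only [RotationSystem.pay, ρ.next_fst, h, true_and, hcycle, hprev, Equiv.symm_apply_apply]
  split_ifs <;> first | omega | norm_num

theorem big_div_five_le_mean_vertexCharge (hG : IsObstruction G) (d : G.Dart) :
    big G d.fst / 5 ≤ (∑ i ∈ range 3, ρ.vertexCharge (ρ.next^[i] d)) / 3 := by
  have hfst : (ρ.next (ρ.next d)).fst = d.fst := by rw [ρ.next_fst, ρ.next_fst]
  simp only [sum_range_succ, sum_range_zero, zero_add, iterate_zero_apply, iterate_succ_apply]
  obtain h3 | h4 : valency G d.fst = 3 ∨ 4 ≤ valency G d.fst := by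
    have := hG.three_le d.adj
    omega
  · have := hG.sum_pay_next (ρ := ρ) h3
    simp only [RotationSystem.vertexCharge, ρ.next_fst, h3, big_eq_zero (h3.trans_le (by simp)),
      Nat.cast_ofNat]
    linarith
  · have h0 := ρ.big_div_five_le_vertexCharge h4
    have h1 := ρ.big_div_five_le_vertexCharge (d := ρ.next d) (by rwa [ρ.next_fst])
    have h2 := ρ.big_div_five_le_vertexCharge (d := ρ.next (ρ.next d)) (by rwa [hfst])
    rw [hfst] at h2
    rw [ρ.next_fst] at h1
    linarith

end IsObstruction

end Discharging


section FaceCharge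

open Equiv Equiv.Perm Function Finset

variable {V : Type*} {G : SimpleGraph V}

namespace RotationSystem

variable (ρ : RotationSystem G)

/-- A potential on the darts of the faces of length at least six, whose differences along a face
make the face pay its vertices of degree three in advance. -/
noncomputable def potential (d : G.Dart) : ℚ :=
  if 6 ≤ ρ.faceLength d ∧ valency G d.fst = 3 then
    3 / 2 + ρ.tri d.symm - ρ.tri (ρ.facePerm.symm d).symm
  else 0

/-- The charge of a face, levelled by the potential. -/
noncomputable def levelCharge (d : G.Dart) : ℚ :=
  ρ.faceCharge d + ρ.potential d - ρ.potential (ρ.facePerm d)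

theorem sum_levelCharge [Fintype G.Dart] : ∑ d, ρ.levelCharge d = ∑ d, ρ.faceCharge d := by
  simp only [levelCharge, sum_sub_distrib, sum_add_distrib, Equiv.sum_comp, add_sub_cancel_right]

variable {ρ} {d : G.Dart}

theorem levelCharge_eq_faceCharge [Finite V] (h : ρ.faceLength d ≤ 5) :
    ρ.levelCharge d = ρ.faceCharge d := by
  have h' : ρ.faceLength (ρ.facePerm d) ≤ 5 := by rwa [faceLength_facePerm]
  rw [levelCharge, potential, potential, if_neg (by omega), if_neg (by omega), add_zero, sub_zero]

theorem le_faceCharge (h : 5 ≤ ρ.faceLength d) :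
    6 - 24 / ρ.faceLength d - ρ.pay d - 2 * ρ.tri d.symm ≤ ρ.faceCharge d := by
  have hbig := big_nonneg (G := G) d.fst
  have hopposite := mul_nonneg (big_nonneg (G := G) (ρ.faceVertex d.symm 2)) (ρ.tri_nonneg d.symm)
  rw [faceCharge, tri_eq_zero (d := d) (by omega)]
  linarith

end RotationSystem

namespace IsObstruction

variable [Finite V] {ρ : RotationSystem G} {d : G.Dart}

theorem tri_add_tri_le_one (hG : IsObstruction G) (h : valency G d.fst = 3) :
    ρ.tri d.symm + ρ.tri (ρ.facePerm.symm d).symm ≤ 1 := by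
  have hprev : ρ.next (ρ.next d) = ρ.next.symm d := by
    rw [Equiv.eq_symm_apply, ρ.next_next_next h]
  by_cases h3 : ρ.faceLength d.symm = 3
  · have h5 := hG.five_le_faceLength_next (ρ := ρ) (d := ρ.next d)
      (by rw [ρ.faceLength_next]; omega)
    rw [hprev, ← ρ.symm_facePerm_symm] at h5
    rw [ρ.tri_eq_zero (d := (ρ.facePerm.symm d).symm) (by omega), add_zero]
    exact ρ.tri_le_one _
  · rw [ρ.tri_eq_zero h3, zero_add]
    exact ρ.tri_le_one _

theorem faceCharge_nonneg (hG : IsObstruction G) (h : ρ.faceLength d ≤ 4) :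
    0 ≤ ρ.faceCharge d := by
  have h3 := hG.three_le_faceLength (ρ := ρ) d
  have hsymm := hG.five_le_faceLength_symm h
  rw [RotationSystem.faceCharge, ρ.pay_eq_zero_of_faceLength_le h,
    ρ.tri_eq_zero (d := d.symm) (by omega)]
  obtain h | h : ρ.faceLength d = 3 ∨ ρ.faceLength d = 4 := by omega
  · norm_num [h, ρ.tri_eq_one h]
  · norm_num [h, ρ.tri_eq_zero (d := d) (by omega), big_nonneg]

theorem le_levelCharge (hG : IsObstruction G) (h : 6 ≤ ρ.faceLength d) :
    1 / 14 ≤ ρ.levelCharge d := by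
  have hcharge := ρ.le_faceCharge (d := d) (by omega)
  have hnot := hG.not_valency_three d.adj
  rw [← ρ.facePerm_fst] at hnot
  have hfirst := hG.tri_add_tri_le_one (ρ := ρ) (d := d)
  have hsecond := hG.tri_add_tri_le_one (ρ := ρ) (d := ρ.facePerm d)
  have hpay := ρ.pay_le_three d
  have hpay_zero := ρ.pay_eq_zero (d := d)
  rw [RotationSystem.levelCharge, RotationSystem.potential, RotationSystem.potential,
    ρ.faceLength_facePerm]
  rw [Equiv.symm_apply_apply] at hsecond ⊢
  obtain h6 | h7 : ρ.faceLength d = 6 ∨ 7 ≤ ρ.faceLength d := by omega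
  · have htri : ∀ e, ρ.faceLength e = ρ.faceLength d → ρ.tri e.symm = 0 := fun e he ↦
      ρ.tri_eq_zero (hG.faceLength_symm_ne_three (he.trans h6))
    rw [htri _ rfl, h6] at hcharge
    rw [htri _ rfl, htri _ (ρ.faceLength_facePerm d), htri _ (ρ.faceLength_facePerm_symm d)]
    split_ifs <;> grind
  · have hlen : (24 : ℚ) / ρ.faceLength d ≤ 24 / 7 := by
      gcongr
      exact_mod_cast h7
    have := ρ.tri_le_one d.symm
    split_ifs <;> grind

end IsObstruction

end FaceCharge


section FiveFaces

open Equiv Equiv.Perm Function Finset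

variable {V : Type*} {G : SimpleGraph V}

theorem exists_sum_range_five_eq {a : ℕ → ℚ} (hzero : ∀ i, a i = 0 ∨ a (i + 1) = 0)
    (hcycle : a 5 = a 0) : ∃ i j, i + 2 ≤ j ∧ j < 5 ∧ ∑ k ∈ range 5, a k = a i + a j := by
  suffices h : ∑ k ∈ range 5, a k = a 0 + a 2 ∨ ∑ k ∈ range 5, a k = a 0 + a 3 ∨
      ∑ k ∈ range 5, a k = a 1 + a 3 ∨ ∑ k ∈ range 5, a k = a 1 + a 4 ∨
      ∑ k ∈ range 5, a k = a 2 + a 4 by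
    rcases h with h | h | h | h | h
    exacts [⟨0, 2, by simp, by simp, h⟩, ⟨0, 3, by simp, by simp, h⟩, ⟨1, 3, by simp, by simp, h⟩,
      ⟨1, 4, by simp, by simp, h⟩, ⟨2, 4, by simp, by simp, h⟩]
  simp only [sum_range_succ, sum_range_zero]
  grind

namespace RotationSystem

variable (ρ : RotationSystem G)

/-- The final charge of a face of length five. -/
noncomputable def fiveCharge (d : G.Dart) : ℚ := ∑ i ∈ range 5, ρ.faceCharge (ρ.facePerm^[i] d)

/-- What a face of length five pays to its vertices. -/
noncomputable def fivePay (d : G.Dart) : ℚ := ∑ i ∈ range 5, ρ.pay (ρ.facePerm^[i] d)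

variable {ρ} {d : G.Dart}

theorem faceCharge_of_faceLength_eq_five (h : ρ.faceLength d = 5) :
    ρ.faceCharge d = 6 / 5 - ρ.pay d - 2 * ρ.tri d.symm + big G d.fst +
      big G (ρ.faceVertex d.symm 2) * ρ.tri d.symm := by
  rw [faceCharge, tri_eq_zero (d := d) (by omega), h, Nat.cast_ofNat]
  ring

theorem six_sub_fivePay_le [Finite V] (h : ρ.faceLength d = 5)
    (h3 : ∀ i, ρ.faceLength (ρ.facePerm^[i] d).symm ≠ 3) : 6 - ρ.fivePay d ≤ ρ.fiveCharge d := by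
  have hface : ∀ i, 6 / 5 - ρ.pay (ρ.facePerm^[i] d) ≤ ρ.faceCharge (ρ.facePerm^[i] d) := by
    intro i
    rw [faceCharge_of_faceLength_eq_five ((ρ.faceLength_iterate_facePerm d i).trans h),
      tri_eq_zero (h3 i)]
    linarith [big_nonneg (G := G) (ρ.facePerm^[i] d).fst]
  calc 6 - ρ.fivePay d
    _ = ∑ i ∈ range 5, (6 / 5 - ρ.pay (ρ.facePerm^[i] d)) := by
      rw [sum_sub_distrib, sum_const, card_range, fivePay]
      norm_num
    _ ≤ ρ.fiveCharge d := sum_le_sum fun i _ ↦ hface i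

theorem fiveCharge_facePerm [Finite V] (h : ρ.faceLength d = 5) :
    ρ.fiveCharge (ρ.facePerm d) = ρ.fiveCharge d := by
  have hshift := (sum_range_succ' (fun i ↦ ρ.faceCharge (ρ.facePerm^[i] d)) 5).symm.trans
    (sum_range_succ _ _)
  rw [iterate_facePerm_of_faceLength h] at hshift
  exact add_right_cancel hshift

theorem fiveCharge_iterate [Finite V] (h : ρ.faceLength d = 5) (i : ℕ) :
    ρ.fiveCharge (ρ.facePerm^[i] d) = ρ.fiveCharge d := by
  induction i with
  | zero => rfl
  | succ i ih =>
    rw [iterate_succ_apply',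
      fiveCharge_facePerm ((faceLength_iterate_facePerm ρ d i).trans h), ih]

end RotationSystem

namespace IsObstruction

variable [Finite V] {ρ : RotationSystem G} {d : G.Dart}

theorem pay_eq_zero_or (hG : IsObstruction G) (d : G.Dart) :
    ρ.pay d = 0 ∨ ρ.pay (ρ.facePerm d) = 0 := by
  by_contra! h
  refine hG.not_valency_three d.adj (ρ.valency_eq_three_of_pay_ne_zero h.1) ?_
  rw [← ρ.facePerm_fst]
  exact ρ.valency_eq_three_of_pay_ne_zero h.2

theorem exists_fivePay_eq (hG : IsObstruction G) (h : ρ.faceLength d = 5) :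
    ∃ i j, i + 2 ≤ j ∧ j < 5 ∧
      ρ.fivePay d = ρ.pay (ρ.facePerm^[i] d) + ρ.pay (ρ.facePerm^[j] d) := by
  refine exists_sum_range_five_eq (fun i ↦ ?_) ?_
  · rw [iterate_succ_apply']
    exact hG.pay_eq_zero_or _
  · rw [ρ.iterate_facePerm_of_faceLength h, iterate_zero_apply]

theorem fivePay_le_six (hG : IsObstruction G) (h : ρ.faceLength d = 5) : ρ.fivePay d ≤ 6 := by
  obtain ⟨i, j, -, -, hsum⟩ := hG.exists_fivePay_eq h
  linarith [ρ.pay_le_three (ρ.facePerm^[i] d), ρ.pay_le_three (ρ.facePerm^[j] d)]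

theorem pay_eq_three (hG : IsObstruction G) (h : ρ.faceLength d = 5) (hpay : 6 ≤ ρ.fivePay d)
    (h3 : valency G d.fst = 3) :
    ρ.pay d = 3 ∧ (valency G (ρ.faceVertex d 2) = 3 ∨ valency G (ρ.faceVertex d 3) = 3) := by
  have hvertex : ∀ i, valency G (ρ.faceVertex d i) ≠ 3 → ρ.pay (ρ.facePerm^[i] d) = 0 :=
    fun _ ↦ ρ.pay_eq_zero
  have hnot : ∀ i, valency G (ρ.faceVertex d i) = 3 → valency G (ρ.faceVertex d (i + 1)) ≠ 3 :=
    fun i ↦ hG.not_valency_three (ρ.adj_faceVertex d i)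
  have hlast : ρ.faceVertex d 5 = d.fst := ρ.faceVertex_add_faceLength h 0
  have h1 := hvertex 1 (hnot 0 h3)
  have h4 := hvertex 4 fun h' ↦ hnot 4 h' (hlast ▸ h3)
  have hle := ρ.pay_le_three d
  have hle2 := ρ.pay_le_three (ρ.facePerm^[2] d)
  have hle3 := ρ.pay_le_three (ρ.facePerm^[3] d)
  simp only [RotationSystem.fivePay, sum_range_succ, sum_range_zero, iterate_zero_apply, h1, h4]
    at hpay
  have h23 : ρ.pay (ρ.facePerm^[2] d) = 0 ∨ ρ.pay (ρ.facePerm^[3] d) = 0 := by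
    rw [iterate_succ_apply']
    exact hG.pay_eq_zero_or _
  refine ⟨?_, ?_⟩
  · grind
  · by_contra! h'
    linarith [hvertex 2 h'.1, hvertex 3 h'.2]

theorem fiveCharge_of_triangle (hG : IsObstruction G) (h : ρ.faceLength d = 5)
    (h3 : ρ.faceLength d.symm = 3) :
    ρ.fiveCharge d = 4 - ρ.fivePay d + ∑ i ∈ range 5, big G (ρ.faceVertex d i) +
      big G (ρ.faceVertex d.symm 2) := by
  have hface : ∀ i ∈ range 5, ρ.faceCharge (ρ.facePerm^[i] d) =
      6 / 5 - ρ.pay (ρ.facePerm^[i] d) + big G (ρ.faceVertex d i) +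
        if i = 0 then big G (ρ.faceVertex d.symm 2) - 2 else 0 := by
    intro i hi
    have hi5 := mem_range.1 hi
    rw [ρ.faceCharge_of_faceLength_eq_five ((ρ.faceLength_iterate_facePerm d i).trans h)]
    split_ifs with hi0
    · rw [hi0, iterate_zero_apply, ρ.tri_eq_one h3, show ρ.faceVertex d 0 = d.fst from rfl]
      ring
    · have h5 := hG.five_le_faceLength_symm_iterate h h3 (Nat.pos_of_ne_zero hi0) hi5
      rw [ρ.tri_eq_zero (d := (ρ.facePerm^[i] d).symm) (by omega),
        show ρ.faceVertex d i = (ρ.facePerm^[i] d).fst from rfl]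
      ring
  rw [RotationSystem.fiveCharge, sum_congr rfl hface, sum_add_distrib, sum_add_distrib,
    sum_sub_distrib, sum_const, card_range, ← RotationSystem.fivePay, sum_ite_eq', if_pos (by simp)]
  norm_num
  ring

theorem fivePay_le_five (hG : IsObstruction G) (h : ρ.faceLength d = 5)
    (h3 : ρ.faceLength d.symm = 3) : ρ.fivePay d ≤ 5 := by
  obtain ⟨i, j, hij, hj, hsum⟩ := hG.exists_fivePay_eq h
  have hfar : ρ.pay (ρ.facePerm^[j] d) ≤ 2 := by
    obtain ⟨k, rfl⟩ := Nat.exists_eq_add_of_le' (show 1 ≤ j by omega)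
    refine ρ.pay_le_two (hG.five_le_faceLength_symm_iterate h h3 k.succ_pos hj) ?_
    rw [iterate_succ_apply', Equiv.symm_apply_apply]
    exact hG.five_le_faceLength_symm_iterate h h3 (by omega) (by omega)
  linarith [ρ.pay_le_three (ρ.facePerm^[i] d)]

theorem fivePay_le_three (hG : IsObstruction G) (h : ρ.faceLength d = 5)
    (h3 : ρ.faceLength d.symm = 3) (h4 : ∀ i < 5, valency G (ρ.faceVertex d i) ≤ 4)
    (hx : valency G (ρ.faceVertex d.symm 2) ≤ 4) : ρ.fivePay d ≤ 3 := by
  have P := hG.pentagon h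
  have hmem : ∀ i < 5, ρ.faceVertex d i ∈ [ρ.faceVertex d 0, ρ.faceVertex d 1, ρ.faceVertex d 2,
      ρ.faceVertex d 3, ρ.faceVertex d 4] := by
    intro i hi
    interval_cases i <;> simp
  obtain ⟨i, j, hij, hj, hsum⟩ := hG.exists_fivePay_eq h
  have hpair : ρ.pay (ρ.facePerm^[i] d) = 0 ∨ ρ.pay (ρ.facePerm^[j] d) = 0 := by
    by_contra! hpay
    have := hG.eq_of_valency_le_three P (ρ.adj_faceVertex_symm_two d)
      (ρ.faceVertex_symm_two_adj h3) (by simp [h4, hx]) (hmem i (by omega)) (hmem j hj)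
      (ρ.valency_eq_three_of_pay_ne_zero hpay.1).le (ρ.valency_eq_three_of_pay_ne_zero hpay.2).le
    have := P.nodup
    have hi : i < 3 := by omega
    interval_cases j <;> interval_cases i <;> grind
  rcases hpair with h0 | h0 <;>
    linarith [ρ.pay_le_three (ρ.facePerm^[i] d), ρ.pay_le_three (ρ.facePerm^[j] d)]

theorem fiveCharge_pos (hG : IsObstruction G) (h : ρ.faceLength d = 5)
    (h3 : ρ.faceLength d.symm = 3) (h4 : ∀ i < 5, valency G (ρ.faceVertex d i) ≤ 4)
    (hx : valency G (ρ.faceVertex d.symm 2) ≤ 4) : 0 < ρ.fiveCharge d := by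
  have hpay := hG.fivePay_le_three h h3 h4 hx
  rw [hG.fiveCharge_of_triangle h h3, sum_eq_zero fun i hi ↦ big_eq_zero (h4 i (mem_range.1 hi)),
    big_eq_zero hx]
  linarith

theorem fiveCharge_nonneg_of_triangle (hG : IsObstruction G) (h : ρ.faceLength d = 5)
    (h3 : ρ.faceLength d.symm = 3) : 0 ≤ ρ.fiveCharge d := by
  have hpay := hG.fivePay_le_five h h3
  have hnonneg : ∀ i ∈ range 5, 0 ≤ big G (ρ.faceVertex d i) := fun i _ ↦ big_nonneg _
  by_cases h4 : ∀ i < 5, valency G (ρ.faceVertex d i) ≤ 4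
  · by_cases hx : valency G (ρ.faceVertex d.symm 2) ≤ 4
    · exact (hG.fiveCharge_pos h h3 h4 hx).le
    · rw [hG.fiveCharge_of_triangle h h3, big_eq_one (by omega)]
      linarith [sum_nonneg hnonneg]
  · push Not at h4
    obtain ⟨i, hi, h5⟩ := h4
    have := single_le_sum hnonneg (mem_range.2 hi)
    rw [big_eq_one h5] at this
    rw [hG.fiveCharge_of_triangle h h3]
    linarith [big_nonneg (G := G) (ρ.faceVertex d.symm 2)]

theorem fiveCharge_nonneg (hG : IsObstruction G) (h : ρ.faceLength d = 5) :
    0 ≤ ρ.fiveCharge d := by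
  by_cases h3 : ∃ i, ρ.faceLength (ρ.facePerm^[i] d).symm = 3
  · obtain ⟨i, h3⟩ := h3
    rw [← ρ.fiveCharge_iterate h i]
    exact hG.fiveCharge_nonneg_of_triangle ((ρ.faceLength_iterate_facePerm d i).trans h) h3
  · have hcharge := ρ.six_sub_fivePay_le h (not_exists.1 h3)
    linarith [hG.fivePay_le_six h]

end IsObstruction

end FiveFaces


/-! ### Toroidal graphs -/

section Toroidal

open Equiv Equiv.Perm Function Finset

variable {V : Type*} {G : SimpleGraph V}

namespace RotationSystem

variable (ρ : RotationSystem G)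

/-- The final charge at a dart, averaged over three consecutive darts at its initial vertex and
over five consecutive darts of its face. -/
noncomputable def meanCharge (d : G.Dart) : ℚ :=
  (∑ i ∈ range 3, ρ.vertexCharge (ρ.next^[i] d)) / 3 +
    (∑ i ∈ range 5, ρ.levelCharge (ρ.facePerm^[i] d)) / 5

theorem sum_meanCharge [Finite V] [Fintype G.Dart] :
    ∑ d, ρ.meanCharge d =
      -24 * ∑ d : G.Dart, ((1 : ℚ) / valency G d.fst + 1 / ρ.faceLength d - 1 / 2) := by
  rw [← ρ.sum_charge, ← ρ.sum_levelCharge, ← sum_iterate_mean ρ.next ρ.vertexCharge three_ne_zero,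
    ← sum_iterate_mean ρ.facePerm ρ.levelCharge (n := 5) (by simp), ← sum_add_distrib]
  rfl

/-- The rotation systems whose charges all vanish. -/
structure IsTight : Prop where
  valency_le_four (v : V) : valency G v ≤ 4
  faceLength_le_five (d : G.Dart) : ρ.faceLength d ≤ 5
  fiveCharge_eq_zero {d : G.Dart} : ρ.faceLength d = 5 → ρ.fiveCharge d = 0

theorem faceVertex_next (d : G.Dart) (i : ℕ) :
    ρ.faceVertex (ρ.next d) i = ρ.faceVertex d.symm (i + 1) := rfl

theorem faceVertex_next_last [Finite V] {d : G.Dart} {n : ℕ} (h : ρ.faceLength (ρ.next d) = n + 1) :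
    ρ.faceVertex (ρ.next d) n = ρ.faceVertex d 1 := by
  rw [faceLength_next] at h
  rw [faceVertex_next, ← Nat.zero_add (n + 1), faceVertex_add_faceLength h, faceVertex_symm_zero]

end RotationSystem

namespace IsObstruction

variable [Finite V] {ρ : RotationSystem G} {d : G.Dart}

theorem faceVertex_next_ne (hG : IsObstruction G) {n : ℕ} (h : ρ.faceLength (ρ.next d) = n + 2) :
    ρ.faceVertex (ρ.next d) n ≠ ρ.faceVertex d 2 := by
  rw [ρ.faceLength_next] at h
  rw [ρ.faceVertex_next, ← ρ.facePerm_symm_fst_of_faceLength h]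
  exact (hG.faceVertex_symm_two_ne d.symm).symm

theorem mean_levelCharge_nonneg (hG : IsObstruction G) (d : G.Dart) :
    0 ≤ (∑ i ∈ range 5, ρ.levelCharge (ρ.facePerm^[i] d)) / 5 := by
  have hlen := ρ.faceLength_iterate_facePerm d
  refine div_nonneg ?_ (by simp)
  obtain h4 | h5 | h6 : ρ.faceLength d ≤ 4 ∨ ρ.faceLength d = 5 ∨ 6 ≤ ρ.faceLength d := by omega
  · refine sum_nonneg fun i _ ↦ ?_
    rw [ρ.levelCharge_eq_faceCharge (by grind)]
    exact hG.faceCharge_nonneg (by grind)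
  · rw [sum_congr rfl fun i _ ↦ ρ.levelCharge_eq_faceCharge (by grind)]
    exact hG.fiveCharge_nonneg h5
  · exact sum_nonneg fun i _ ↦ (by norm_num : (0 : ℚ) ≤ 1 / 14).trans <|
      hG.le_levelCharge (by grind)

theorem meanCharge_nonneg (hG : IsObstruction G) (d : G.Dart) : 0 ≤ ρ.meanCharge d := by
  have hvertex := hG.big_div_five_le_mean_vertexCharge (ρ := ρ) d
  have hface := hG.mean_levelCharge_nonneg (ρ := ρ) d
  have hbig := big_nonneg (G := G) d.fst
  unfold RotationSystem.meanCharge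
  linarith

theorem isTight (hG : IsObstruction G)
    (hχ : 2 * (Nat.card G.ConnectedComponent : ℤ) - 2 ≤ ρ.eulerChar) : ρ.IsTight := by
  have := Fintype.ofFinite G.Dart
  have hzero : ∀ d, ρ.meanCharge d = 0 := by
    have hsum : ∑ d, ρ.meanCharge d ≤ 0 := by
      rw [ρ.sum_meanCharge]
      linarith [ρ.sum_curvature_nonneg hχ]
    have := (sum_eq_zero_iff_of_nonneg fun d _ ↦ hG.meanCharge_nonneg (ρ := ρ) d).1
      (hsum.antisymm (sum_nonneg fun d _ ↦ hG.meanCharge_nonneg d))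
    exact fun d ↦ this d (mem_univ d)
  unfold RotationSystem.meanCharge at hzero
  have hvertex := hG.big_div_five_le_mean_vertexCharge (ρ := ρ)
  have hface := hG.mean_levelCharge_nonneg (ρ := ρ)
  have hlevel : ∀ d, ∑ i ∈ range 5, ρ.levelCharge (ρ.facePerm^[i] d) = 0 := fun d ↦ by
    linarith [hzero d, hvertex d, hface d, big_nonneg (G := G) d.fst]
  refine ⟨fun v ↦ ?_, fun d ↦ ?_, fun {d} h ↦ ?_⟩
  · by_contra! h5
    obtain ⟨w, hw⟩ := Set.nonempty_of_ncard_ne_zero (show (G.neighborSet v).ncard ≠ 0 from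
      fun h ↦ by rw [valency] at h5; omega)
    have hbig : big G v / 5 ≤ _ := hvertex ⟨(v, w), hw⟩
    rw [big_eq_one h5] at hbig
    linarith [hzero ⟨(v, w), hw⟩, hface ⟨(v, w), hw⟩]
  · by_contra! h6
    refine (sum_pos (fun i _ ↦ ?_) (by simp)).ne' (hlevel d)
    refine (by norm_num : (0 : ℚ) < 1 / 14).trans_le (hG.le_levelCharge ?_)
    rwa [ρ.faceLength_iterate_facePerm]
  · rw [← hlevel d, RotationSystem.fiveCharge]
    refine sum_congr rfl fun i _ ↦ (ρ.levelCharge_eq_faceCharge ?_).symm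
    rw [ρ.faceLength_iterate_facePerm, h]

end IsObstruction

namespace RotationSystem.IsTight

variable [Finite V] {ρ : RotationSystem G} {d : G.Dart}

theorem faceLength_symm_eq_five (hρ : ρ.IsTight) (hG : IsObstruction G) (h : ρ.faceLength d ≤ 4) :
    ρ.faceLength d.symm = 5 :=
  (hρ.faceLength_le_five _).antisymm (hG.five_le_faceLength_symm h)

theorem faceLength_ne_three (hρ : ρ.IsTight) (hG : IsObstruction G) (d : G.Dart) :
    ρ.faceLength d ≠ 3 := by
  intro h3
  have h5 := hρ.faceLength_symm_eq_five hG (h3.trans_le (by simp))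
  exact (hG.fiveCharge_pos h5 h3 (fun _ _ ↦ hρ.valency_le_four _) (hρ.valency_le_four _)).ne'
    (hρ.fiveCharge_eq_zero h5)

theorem six_le_fivePay (hρ : ρ.IsTight) (hG : IsObstruction G) (h : ρ.faceLength d = 5) :
    6 ≤ ρ.fivePay d := by
  have := ρ.six_sub_fivePay_le h fun _ ↦ hρ.faceLength_ne_three hG _
  linarith [hρ.fiveCharge_eq_zero h]

theorem exists_faceLength_eq_five [Nonempty G.Dart] (hρ : ρ.IsTight) (hG : IsObstruction G) :
    ∃ d, ρ.faceLength d = 5 := by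
  obtain ⟨d⟩ := ‹Nonempty G.Dart›
  obtain h4 | h5 := Nat.lt_or_ge (ρ.faceLength d) 5
  · exact ⟨d.symm, hρ.faceLength_symm_eq_five hG (by omega)⟩
  · exact ⟨d, (hρ.faceLength_le_five d).antisymm h5⟩

theorem exists_faceLength_eq_five_valency_eq_three [Nonempty G.Dart] (hρ : ρ.IsTight)
    (hG : IsObstruction G) : ∃ d, ρ.faceLength d = 5 ∧ valency G d.fst = 3 := by
  obtain ⟨d, hd⟩ := hρ.exists_faceLength_eq_five hG
  by_contra! h
  have hzero : ρ.fivePay d = 0 := sum_eq_zero fun i _ ↦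
    pay_eq_zero (h _ ((ρ.faceLength_iterate_facePerm d i).trans hd))
  linarith [hρ.six_le_fivePay hG hd]

theorem exists_faceLength_eq_four_valency_eq_three [Nonempty G.Dart] (hρ : ρ.IsTight)
    (hG : IsObstruction G) : ∃ d, ρ.faceLength d = 4 ∧ valency G d.fst = 3 := by
  obtain ⟨d, hd, hv⟩ := hρ.exists_faceLength_eq_five_valency_eq_three hG
  have hpay := (hG.pay_eq_three hd (hρ.six_le_fivePay hG hd) hv).1
  obtain ⟨e, he, hfst⟩ : ∃ e, ρ.faceLength e ≤ 4 ∧ e.fst = d.fst := by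
    unfold pay at hpay
    split_ifs at hpay with _ hsmall
    · obtain h | h := hsmall
      · exact ⟨_, h, ρ.next_fst d⟩
      · exact ⟨_, h, by rw [← ρ.next_fst, Equiv.apply_symm_apply]⟩
    all_goals norm_num at hpay
  have := hG.three_le_faceLength (ρ := ρ) e
  have := hρ.faceLength_ne_three hG e
  exact ⟨e, by omega, hfst ▸ hv⟩

theorem isEmpty_dart (hρ : ρ.IsTight) (hG : IsObstruction G) : IsEmpty G.Dart := by
  by_contra! hne
  -- Around a vertex of degree three, a face of length four lies between two faces of length five.
  obtain ⟨g, hg, hv⟩ := hρ.exists_faceLength_eq_four_valency_eq_three hG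
  have hcycle := ρ.next_next_next hv
  set l := ρ.next g
  set k := ρ.next l
  have hl5 : ρ.faceLength l = 5 :=
    (ρ.faceLength_next g).trans (hρ.faceLength_symm_eq_five hG hg.le)
  have hk5 : ρ.faceLength k = 5 := by
    refine (hρ.faceLength_le_five k).antisymm ?_
    by_contra! hk4
    have := hG.five_le_faceLength_next (ρ := ρ) (d := k) (by omega)
    rw [hcycle] at this
    omega
  have hk0 : ρ.faceVertex k 0 = ρ.faceVertex g 0 := (ρ.next_fst l).trans (ρ.next_fst g)
  have hl0 : ρ.faceVertex l 0 = ρ.faceVertex g 0 := ρ.next_fst g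
  have hg4 : ρ.faceLength (ρ.next k) = 4 := by rw [hcycle, hg]
  have hg3 := ρ.faceVertex_next_last hg4
  have hak := hG.faceVertex_next_ne hg4
  rw [hcycle] at hg3 hak
  have hthree {e : G.Dart} (he : ρ.faceLength e = 5) (h0 : ρ.faceVertex e 0 = ρ.faceVertex g 0) :=
    (hG.pay_eq_three he (hρ.six_le_fivePay hG he) (h0 ▸ hv : valency G (ρ.faceVertex e 0) = 3)).2
  have S := hG.square hg
  have P := hG.pentagon hk5
  have Q := hG.pentagon hl5
  rw [hg3] at S
  rw [hk0, ρ.faceVertex_next_last hk5] at P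
  rw [hl0, ρ.faceVertex_next_last hl5] at Q
  exact hG.not_hub S P Q hak (hG.faceVertex_next_ne hl5).symm (hG.faceVertex_next_ne hk5)
    hρ.valency_le_four hv.le ((hthree hk5 hk0).imp Eq.le Eq.le) ((hthree hl5 hl0).imp Eq.le Eq.le)

end RotationSystem.IsTight

theorem IsToroidal.isDecomposable [Finite V] (hG : IsToroidal G) (havoid : AvoidsConfigurations G) :
    IsDecomposable 2 1 G := by
  refine isDecomposable_of_hasReducible fun H hle hne ↦ ?_
  by_contra hred
  obtain ⟨ρ, hρ⟩ := hG.anti hle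
  have hH : IsObstruction H := ⟨havoid.anti hle, hred⟩
  obtain ⟨v, w, hvw⟩ := SimpleGraph.ne_bot_iff_exists_adj.1 hne
  exact ((hH.isTight hρ).isEmpty_dart hH).false ⟨(v, w), hvw⟩

end Toroidal

end ToroidalDecomposition

theorem theorem1p7 {V : Type*} [Finite V] (G : SimpleGraph V)
    (hG : ToroidalDecomposition.IsToroidal G) :
    (ToroidalDecomposition.AvoidsConfigurations G →
      ToroidalDecomposition.IsDecomposable 2 1 G) ∧
    (∀ i j : ℕ, (i, j) ∈ ({(3, 4), (3, 6), (4, 6), (4, 7)} : Set (ℕ × ℕ)) →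
      ToroidalDecomposition.HasNoCycleOfLength i G →
      ToroidalDecomposition.HasNoCycleOfLength j G →
      ToroidalDecomposition.AvoidsConfigurations G) :=
  ⟨hG.isDecomposable, fun _ _ hij hi hj ↦
    ToroidalDecomposition.avoidsConfigurations_of_hasNoCycleOfLength hij hi hj⟩
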